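/- **Avoiders.** A permutation $\pi=a_1a_2\cdots a_n$ of $[n]=\{1,\dots,n\}$, $n\ge 0$, is an *avoider* if there are no $i<j<k<\ell$ with $a_j<a_\ell<a_i<a_k$ (pattern 3-1-4-2) and no $i<j<j+1<\ell$ with $a_{j+1}<a_i<a_\ell<a_j$ (pattern 2-41-3). Let $\mathrm{asc}$, $\mathrm{des}$, $\mathrm{lmax}$, $\mathrm{rmax}$ be the numbers of ascents, descents, left-to-right maxima and right-to-left maxima of a permutation, and let $\epsilon$ be the empty permutation. For permutations $\sigma,\tau$ let $\sigma\oplus\tau=\sigma\tau'$, with $\tau'$ obtained from $\tau$ by adding $|\sigma|$ to each letter. For a word $w$ with distinct letters, $\mathrm{st}(w)$ replaces each letter by its rank; for a set $V$, $\mathrm{st}_V^{-1}$ replaces the letter $r$ by the $r$th smallest element of $V$. *The map $\psi$.* Let $\pi=\sigma n\tau$ be an avoider of length $n$ whose first letter is not $n$ and in which $n$ precedes $n-1$. Let $\sigma_1,\dots,\sigma_k$ be the maximal intervals of $\sigma$ (maximal sets of letters of $\sigma$ that are consecutive integers), in increasing order. For $1\le i\le k$ let $w_i$ be the subword of $\tau$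 formed by the letters greater than all letters of $\sigma_i$ and smaller than all letters of $\sigma_{i+1}$ (the last condition being void for $i=k$). Write $w_i=u_i\,\hat 0_i\,v_i$ with $\hat 0_i=\min w_i$, and let $m_i$ be the number of letters of $v_i$ that are smaller than all letters of $u_i$. Put $L=\bigcup_{i=1}^k\{x+m_i+1: x\in\sigma_i\}$ and $R=[n-1]\setminus L$. Then $\psi(\pi)=\mathrm{st}_L^{-1}(\mathrm{st}(\sigma))\;n\;\mathrm{st}_R^{-1}(\mathrm{st}(\tau))$. *The map $\phi$.* For an avoider $\pi$ of length $n-1$ and $1\le i\le\mathrm{lmax}(\pi)$ let $\hat\pi$ be obtained by inserting $n$ immediately to the left of the $i$th left-to-right maximum of $\pi$; for $\pi=\epsilon$ and $i=1$ let $\hat\pi=1$. Put $\phi_1(\pi)=\hat\pi$, and $\phi_i(\pi)=\psi(\hat\pi)$ if $i>1$. **Trees.** A *$\beta(1,0)$-tree* is a rooted plane tree with a label on each node such that the root has label equal to the sum of its children's labels, every other node has a positive label, every leaf other than the root has label $1$, and every other non-root node has label at most the sum of its children's labels. Let $\bullet$ be the one-node tree (its root label is the empty sum $0$). For a tree $t$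 with root label $k$ and $1\le i\le k$ (or $t=\bullet$ and $i=1$) let $\lambda_i t$ be obtained by joining a new root to the old root and giving both the label $i$. For $u,v\ne\bullet$ let $u\oplus v$ be obtained by identifying the roots of $u$ and $v$, the subtrees of $u$ preceding those of $v$, and adding the root labels; let $u\oslash v$ be obtained by identifying the rightmost leaf of $u$ with the root of $v$ and giving that node the label $1$. The right path of $t$ leads from the root to the rightmost leaf; if it has $k$ edges and $1\le i\le k$ (or $t=\bullet$ and $i=1$), let $\gamma_i t$ be obtained by attaching a new rightmost leaf with label $1$ to the $i$th node of the right path (the root being the first) and adding $1$ to the label of every node on the new right path except the new leaf. Every $\beta(1,0)$-tree other than $\bullet$ is of exactly one of the forms $\lambda_i t$ and $u\oplus v$. Maps $f$ and $h$ are defined by $$f(\bullet)=\epsilon,\quad f(\lambda_i t)=\phi_i(f(t)),\quad f(u\oplus v)=f(u)\oplus f(v);$$ $$h(\bullet)=\bullet,\quad h(\lambda_i t)=\gamma_i(h(t)),\quad h(u\oplus v)=h(v)\oslash h(u).$$ **Corollary.** Let $n\ge 0$. The map $f$ is a bijection from the $\beta(1,0)$-trees on $n+1$ nodes onto the avoiders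 of length $n$, and $h$ maps the set of $\beta(1,0)$-trees on $n+1$ nodes to itself. The conjugate $g$ of $h$ by $f$ (first $f^{-1}$, then $h$, then $f$) is an involution on the set of avoiders of length $n$, and it sends $(\mathrm{asc},\mathrm{lmax},\mathrm{rmax})$ to $(\mathrm{des},\mathrm{rmax},\mathrm{lmax})$: for every avoider $\pi$ of length $n$, $$\bigl(\mathrm{asc}(\pi),\mathrm{lmax}(\pi),\mathrm{rmax}(\pi)\bigr)=\bigl(\mathrm{des}(g(\pi)),\mathrm{rmax}(g(\pi)),\mathrm{lmax}(g(\pi))\bigr).$$ -/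

import Mathlib

/-! Rooted plane trees labelled by natural numbers, and the beta(1,0)-trees among them. -/

/-- A rooted plane tree with a natural number on each node: the label of the root, followed by
the list, from left to right, of the subtrees hanging from the root. -/
inductive LTree where
  | node (label : ℕ) (children : List LTree) : LTree

namespace LTree

/-- The tree with a single node. Its root label is the empty sum `0`. -/
def leaf : LTree := node 0 []

instance : Inhabited LTree := ⟨leaf⟩

/-- The label of the root. -/
def label : LTree → ℕ
  | node a _ => a

/-- The subtrees hanging from the root, from left to right. -/
def children : LTree → List LTree
  | node _ cs => cs

/-- The tree with its root relabelled by `a`. -/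
def setLabel (a : ℕ) : LTree → LTree
  | node _ cs => node a cs

/-- The sum of the root labels of a list of trees. -/
def labelSum (cs : List LTree) : ℕ := (cs.map label).sum

mutual
/-- The number of nodes of a tree. -/
def size : LTree → ℕ
  | node _ cs => 1 + sizeForest cs
/-- The number of nodes of a list of trees. -/
def sizeForest : List LTree → ℕ
  | [] => 0
  | c :: cs => size c + sizeForest cs
end

/-- The labelling rules for a non-root node and everything below it: labels are positive, a leaf
has label `1`, and an internal node has label at most the sum of its children's labels. -/
inductive IsGood : LTree → Prop
  | leaf : IsGood (node 1 [])
  | node (a : ℕ) (cs : List LTree) : cs ≠ [] → 1 ≤ a → a ≤ labelSum cs →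
      (∀ c ∈ cs, IsGood c) → IsGood (LTree.node a cs)

/-- A beta(1,0)-tree: the root label is the sum of the children's labels, and all nodes below
the root obey the rules above. (For the one-node tree the root label is the empty sum.) -/
def IsBeta (t : LTree) : Prop :=
  t.label = labelSum t.children ∧ ∀ c ∈ t.children, IsGood c

/-- The set of beta(1,0)-trees on `n` nodes. -/
def betaTrees (n : ℕ) : Set LTree := {t | IsBeta t ∧ size t = n}

/-- `lam i t`: join a new root to the old root; both get the label `i`. -/
def lam (i : ℕ) (t : LTree) : LTree := node i [t.setLabel i]

/-- `u ⊕ v`: identify the roots, the subtrees of `u` coming before those of `v`; the root labels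
are added. -/
def oplus (u v : LTree) : LTree := node (u.label + v.label) (u.children ++ v.children)

mutual
/-- `obslash u v`: identify the rightmost leaf of `u` with the root of `v`, and give that node
the label `1`. -/
def obslash : LTree → LTree → LTree
  | node _ [], v => v.setLabel 1
  | node a (c :: cs), v => node a (obslashForest (c :: cs) v)
/-- The same operation carried out in the last tree of a list. -/
def obslashForest : List LTree → LTree → List LTree
  | [], _ => []
  | [c], v => [obslash c v]
  | c :: d :: cs, v => c :: obslashForest (d :: cs) v
end

/-- `gam i t`: attach a new rightmost leaf, labelled `1`, to the `i`th node (the root being the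
first) of the right path of `t`, and add `1` to the label of every node on the new right path
other than the new leaf. (The value for `i = 0`, or if there is no `i`th node on the right path,
is immaterial.) -/
def gam : ℕ → LTree → LTree
  | 0, t => t
  | 1, node a cs => node (a + 1) (cs ++ [node 1 []])
  | i + 2, node a cs =>
    match cs.getLast? with
    | none => node a cs
    | some c => node (a + 1) (cs.dropLast ++ [gam (i + 1) c])

mutual
/-- The map `h`, given by `h leaf = leaf`, `h (lam i t) = gam i (h t)` and
`h (u ⊕ v) = obslash (h v) (h u)` for `u, v ≠ leaf`. The tree with the subtrees `c₁, …, cₖ` at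
its root is `lam i₁ t₁ ⊕ ⋯ ⊕ lam iₖ tₖ`, where `iⱼ` is the root label of `cⱼ` and `tⱼ` differs
from `cⱼ` only in its root label. The value of `h` does not depend on the root label. -/
def h : LTree → LTree
  | node _ cs => hForest cs
/-- The map `h` on the tree that has the given list of subtrees. -/
def hForest : List LTree → LTree
  | [] => leaf
  | [c] => gam c.label (h c)
  | c :: d :: cs => obslash (hForest (d :: cs)) (gam c.label (h c))
end

end LTree

/-! Permutations of `{1, …, n}` in one-line notation, as lists of natural numbers. -/

namespace PermWord

/-- `π` is a permutation of `{1, …, n}` in one-line notation. -/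
def IsPerm (n : ℕ) (π : List ℕ) : Prop := π.Perm (List.range' 1 n)

/-- `π` has an occurrence `aᵢ aⱼ aₖ aₗ`, `i < j < k < l`, of the pattern 3-1-4-2. -/
def Contains3142 (π : List ℕ) : Prop :=
  ∃ i j k l : Fin π.length, i < j ∧ j < k ∧ k < l ∧
    π.get j < π.get l ∧ π.get l < π.get i ∧ π.get i < π.get k

/-- `π` has an occurrence `aᵢ aⱼ aⱼ₊₁ aₗ`, `i < j < j + 1 < l`, of the pattern 2-41-3. -/
def Contains2413 (π : List ℕ) : Prop :=
  ∃ i j k l : Fin π.length, i < j ∧ (j : ℕ) + 1 = k ∧ k < l ∧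
    π.get k < π.get i ∧ π.get i < π.get l ∧ π.get l < π.get j

/-- The set of avoiders of length `n`. -/
def avoiders (n : ℕ) : Set (List ℕ) :=
  {π | IsPerm n π ∧ ¬ Contains3142 π ∧ ¬ Contains2413 π}

/-- The number of ascents. -/
def asc (π : List ℕ) : ℕ :=
  (Finset.univ.filter fun p : Fin π.length × Fin π.length =>
    (p.1 : ℕ) + 1 = p.2 ∧ π.get p.1 < π.get p.2).card

/-- The number of descents. -/
def des (π : List ℕ) : ℕ :=
  (Finset.univ.filter fun p : Fin π.length × Fin π.length =>
    (p.1 : ℕ) + 1 = p.2 ∧ π.get p.2 < π.get p.1).card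

/-- The number of left-to-right maxima. -/
def lmax (π : List ℕ) : ℕ :=
  (Finset.univ.filter fun i : Fin π.length => ∀ j, j < i → π.get j ≤ π.get i).card

/-- The number of right-to-left maxima. -/
def rmax (π : List ℕ) : ℕ :=
  (Finset.univ.filter fun i : Fin π.length => ∀ j, i < j → π.get j ≤ π.get i).card

/-- The direct sum of two permutations. -/
def oplus (σ τ : List ℕ) : List ℕ := σ ++ τ.map (· + σ.length)

/-- Standardization of a word without repeated letters: a letter is replaced with its rank. -/
def st (w : List ℕ) : List ℕ :=
  w.map fun x => (w.toFinset.filter (· ≤ x)).card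

/-- The inverse of standardization for the underlying set `V`: the letter `r` is replaced with
the `r`th smallest element of `V`. -/
def stInv (V : Finset ℕ) (w : List ℕ) : List ℕ :=
  w.map fun r => (V.sort (· ≤ ·)).getD (r - 1) 0

/-- The letters `x` and `z` of `σ` belong to the same maximal interval of `σ`: all values between
them are letters of `σ`. -/
def SameBlock (σ : List ℕ) (x z : ℕ) : Prop :=
  ∀ v ∈ Finset.Icc (min x z) (max x z), v ∈ σ

instance (σ : List ℕ) (x z : ℕ) : Decidable (SameBlock σ x z) := by
  unfold SameBlock; infer_instance

/-- With `x` in the `i`th maximal interval `σᵢ` of `σ`, the subword `wᵢ` of `τ` formed by the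
letters greater than all those of `σᵢ` and smaller than all those of `σᵢ₊₁, σᵢ₊₂, …`. -/
def gapWord (σ τ : List ℕ) (x : ℕ) : List ℕ :=
  τ.filter fun y => ∀ z ∈ σ, if SameBlock σ x z then z < y else (x < z → y < z)

/-- With `w = u 0̂ v` where `0̂` is the smallest letter of `w`, the number of letters of `v`
that are smaller than all letters of `u`. -/
def mCount (w : List ℕ) : ℕ :=
  let u := w.takeWhile fun y => ∃ z ∈ w, z < y
  let v := (w.dropWhile fun y => ∃ z ∈ w, z < y).tail
  v.countP fun x => ∀ y ∈ u, x < y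

/-- The map `ψ`, on a permutation `π = σ n τ` of `{1, …, n}` in which `n` is not the first letter
and precedes `n - 1`: to each letter of the maximal interval `σᵢ` of `σ` one adds `mᵢ + 1`, which
gives a set `L`, and then `σ` and `τ` are refilled, keeping their patterns, with the elements of
`L` and of `{1, …, n - 1} \ L`. -/
def psi (π : List ℕ) : List ℕ :=
  let n := π.length
  let σ := π.takeWhile fun x => x ≠ n
  let τ := (π.dropWhile fun x => x ≠ n).tail
  let L := σ.toFinset.image fun x => x + mCount (gapWord σ τ x) + 1
  stInv L (st σ) ++ n :: stInv (Finset.Icc 1 (n - 1) \ L) (st τ)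

/-- Insert `N` into a word immediately to the left of the `i`th (`1 ≤ i`) of those letters that
exceed `m` and all letters before them. -/
def insertAux (N : ℕ) : ℕ → ℕ → List ℕ → List ℕ
  | _, _, [] => [N]
  | m, i, a :: l =>
    if m < a then
      if i ≤ 1 then N :: a :: l else a :: insertAux N a (i - 1) l
    else a :: insertAux N m i l

/-- Insert a new largest letter in a permutation immediately to the left of the `i`th
left-to-right maximum (and as the only letter if the permutation is empty). -/
def hat (i : ℕ) (π : List ℕ) : List ℕ := insertAux (π.length + 1) 0 i π

/-- The map `φ`. -/
def phi (i : ℕ) (π : List ℕ) : List ℕ :=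
  if i = 1 then hat i π else psi (hat i π)

end PermWord

namespace LTree

mutual
/-- The map `f` from beta(1,0)-trees to avoiders, given by `f leaf = ε`,
`f (lam i t) = phi i (f t)` and `f (u ⊕ v) = f u ⊕ f v`. As with `h`, its value does not depend
on the root label. -/
def f : LTree → List ℕ
  | node _ cs => fForest cs
/-- The map `f` on the tree that has the given list of subtrees. -/
def fForest : List LTree → List ℕ
  | [] => []
  | c :: cs => PermWord.oplus (PermWord.phi c.label (f c)) (fForest cs)
end

/-- The conjugate by `f` of the map `h`, on permutations of length `n`: the preimage of the
permutation under `f : betaTrees (n + 1) → avoiders n`, followed by `h`, followed by `f`. -/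
noncomputable def conjH (n : ℕ) (π : List ℕ) : List ℕ :=
  f (h (Function.invFunOn f (betaTrees (n + 1)) π))

/-! The equations that characterize `f` and `h`. -/

theorem f_setLabel (a : ℕ) (t : LTree) : f (t.setLabel a) = f t := by
  cases t; simp [setLabel, f]

theorem h_setLabel (a : ℕ) (t : LTree) : h (t.setLabel a) = h t := by
  cases t; simp [setLabel, h]

theorem f_leaf : f leaf = [] := by simp [leaf, f, fForest]

theorem f_lam (i : ℕ) (t : LTree) : f (lam i t) = PermWord.phi i (f t) := by
  cases t; simp [lam, setLabel, label, f, fForest, PermWord.oplus]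

theorem fForest_append (cs ds : List LTree) :
    fForest (cs ++ ds) = PermWord.oplus (fForest cs) (fForest ds) := by
  induction cs with
  | nil => simp [fForest, PermWord.oplus]
  | cons c cs ih =>
    simp [fForest, ih, PermWord.oplus, Function.comp_def, add_assoc, add_comm]

theorem f_oplus (u v : LTree) : f (oplus u v) = PermWord.oplus (f u) (f v) := by
  cases u; cases v; simp [oplus, children, f, fForest_append]

theorem h_leaf : h leaf = leaf := by simp [leaf, h, hForest]

theorem h_lam (i : ℕ) (t : LTree) : h (lam i t) = gam i (h t) := by
  cases t; simp [lam, setLabel, label, h, hForest]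

mutual
theorem obslash_assoc : (a b c : LTree) →
    obslash (obslash a b) c = obslash a (obslash b c)
  | node _ [], node _ [], .node _ _ => by simp [obslash, setLabel]
  | node _ [], node _ (_ :: _), _ => by simp [obslash, setLabel]
  | node _ (d :: ds), b, c => by
    have H := obslashForest_assoc (d :: ds) b c
    cases ds <;> simp_all [obslash, obslashForest]
theorem obslashForest_assoc : (as : List LTree) → (b c : LTree) →
    obslashForest (obslashForest as b) c = obslashForest as (obslash b c)
  | [], _, _ => by simp [obslashForest]
  | [a], b, c => by
    have H := obslash_assoc a b c
    simp [obslashForest, H]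
  | a :: d :: ds, b, c => by
    have H := obslashForest_assoc (d :: ds) b c
    cases ds <;> simp_all [obslashForest]
end

theorem hForest_append (cs ds : List LTree) (hc : cs ≠ []) (hd : ds ≠ []) :
    hForest (cs ++ ds) = obslash (hForest ds) (hForest cs) := by
  induction cs with
  | nil => exact absurd rfl hc
  | cons c cs ih =>
    cases cs with
    | nil =>
      obtain ⟨d, ds, rfl⟩ := List.exists_cons_of_ne_nil hd
      simp [hForest]
    | cons c' cs =>
      have H := ih (by simp)
      simp only [List.cons_append] at H ⊢
      rw [hForest, H, hForest, obslash_assoc]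

theorem h_oplus (u v : LTree) (hu : u.children ≠ []) (hv : v.children ≠ []) :
    h (oplus u v) = obslash (h v) (h u) := by
  cases u; cases v
  simp only [children] at hu hv
  simp [oplus, children, h, hForest_append _ _ hu hv]

end LTree

-- Cut a permutation `π = σ n τ` in front of its largest letter and record three data: the pattern
-- `ρ` of `σ`, the pattern `w` of `n τ`, and for each rank `r` in `σ` the level `g r`, the number of
-- rear letters below the front letter of that rank. The function `g` is monotone, and `build g ρ w`
-- recovers `π`. Avoidance factorises in these data (`avoids_build`): `ρ` and `w` avoid, front
-- letters with different levels come in increasing order (`Blocked`), and every level belongs to a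
-- set of levels that depends on `w` alone (`Allowed w`).
--
-- Maximal intervals of `σ` are the classes of equal level. If `ℓ` is an allowed level at which `ψ`
-- acts, the next allowed level is one less than the smallest letter of `w` in front of the letter
-- `ℓ + 1`, and the number `m_i + 1` measures exactly that jump. Hence `ψ` keeps `ρ` and `w` and
-- replaces each level with the next allowed one (`psi_build`). This is undone by passing to the
-- previous allowed level, which is possible precisely when all levels are positive, that is, when
-- the permutation is not a direct sum of two nonempty ones. So the maps `φ_i` together give a
-- bijection from pairs (avoider of length `n`, admissible `i`) onto indecomposable avoiders of
-- length `n + 1` (`phi_spec`, `phi_inj`, `phi_surj`). Unique decomposition into direct sums then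
-- makes `f` bijective, and along `f` the statistics `lmax`, `rmax`, `asc` become the root label,
-- the length of the right path, and the number of leaves minus one (for trees with an edge).
--
-- On trees, `h` exchanges root label and right path length, and the leaves of `t` and `h t`
-- together number `size t` when `t` has an edge (`hForest_spec`); since `asc + des = n - 1` for
-- positive `n`, this turns `asc` into `des`. Finally `h` also satisfies the dual rules `h (gam i t)
-- = lam i (h t)` and `h (obslash u v) = oplus (h v) (h u)`, so that induction gives `h (h t) = t`.

namespace PermWord

-- Words as functions of the position, and avoidance.

/-- The letter in position `i` (counted from `0`), and `0` beyond the end. -/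
def nth (w : List ℕ) (i : ℕ) : ℕ := w.getD i 0

theorem nth_eq_get (w : List ℕ) (i : Fin w.length) : nth w i = w.get i := by
  simp [nth]

theorem nth_eq_getElem (w : List ℕ) {i : ℕ} (h : i < w.length) : nth w i = w[i] := by
  simp [nth, h]

theorem nth_map (F : ℕ → ℕ) (w : List ℕ) {i : ℕ} (h : i < w.length) :
    nth (w.map F) i = F (nth w i) := by
  simp [nth, h]

theorem nth_append_left (u v : List ℕ) {i : ℕ} (h : i < u.length) :
    nth (u ++ v) i = nth u i := by
  simp [nth, h, List.getElem?_append]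

theorem nth_append_right (u v : List ℕ) {i : ℕ} (h : u.length ≤ i) :
    nth (u ++ v) i = nth v (i - u.length) := by
  simp [nth, List.getElem?_append, not_lt.2 h]

theorem nth_mem {w : List ℕ} {i : ℕ} (h : i < w.length) : nth w i ∈ w := by
  rw [nth_eq_getElem w h]; exact List.getElem_mem h

theorem mem_iff_nth {w : List ℕ} {x : ℕ} : x ∈ w ↔ ∃ i < w.length, nth w i = x := by
  constructor
  · intro h
    obtain ⟨i, hi, rfl⟩ := List.mem_iff_getElem.1 h
    exact ⟨i, hi, nth_eq_getElem w hi⟩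
  · rintro ⟨i, hi, rfl⟩
    exact nth_mem hi

theorem nth_inj {w : List ℕ} (hw : w.Nodup) {i j : ℕ} (hi : i < w.length) (hj : j < w.length)
    (h : nth w i = nth w j) : i = j := by
  rw [nth_eq_getElem w hi, nth_eq_getElem w hj] at h
  exact (hw.getElem_inj_iff).1 h

theorem contains3142_iff {w : List ℕ} : Contains3142 w ↔ ∃ i j k l, i < j ∧ j < k ∧ k < l ∧
    l < w.length ∧ nth w j < nth w l ∧ nth w l < nth w i ∧ nth w i < nth w k := by
  constructor
  · rintro ⟨i, j, k, l, hij, hjk, hkl, h⟩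
    exact ⟨i, j, k, l, hij, hjk, hkl, l.2, by simpa only [nth_eq_get] using h⟩
  · rintro ⟨i, j, k, l, hij, hjk, hkl, hl, h⟩
    refine ⟨⟨i, by omega⟩, ⟨j, by omega⟩, ⟨k, by omega⟩, ⟨l, hl⟩, hij, hjk, hkl, ?_⟩
    simpa only [← nth_eq_get] using h

theorem contains2413_iff {w : List ℕ} : Contains2413 w ↔ ∃ i j l, i < j ∧ j + 1 < l ∧
    l < w.length ∧ nth w (j + 1) < nth w i ∧ nth w i < nth w l ∧ nth w l < nth w j := by
  constructor
  · rintro ⟨i, j, k, l, hij, hjk, hkl, h⟩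
    refine ⟨i, j, l, hij, by rw [hjk]; exact hkl, l.2, ?_⟩
    rw [hjk]
    simpa only [nth_eq_get] using h
  · rintro ⟨i, j, l, hij, hkl, hl, h⟩
    refine ⟨⟨i, by omega⟩, ⟨j, by omega⟩, ⟨j + 1, by omega⟩, ⟨l, hl⟩, hij, rfl, hkl, ?_⟩
    simpa only [← nth_eq_get] using h

/-- Avoidance of 3-1-4-2 and 2-41-3. -/
def Avoids (w : List ℕ) : Prop := ¬ Contains3142 w ∧ ¬ Contains2413 w

theorem mem_avoiders {n : ℕ} {w : List ℕ} : w ∈ avoiders n ↔ IsPerm n w ∧ Avoids w := Iff.rfl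

theorem avoids_iff {w : List ℕ} : Avoids w ↔
    (∀ i j k l, i < j → j < k → k < l → l < w.length →
      ¬ (nth w j < nth w l ∧ nth w l < nth w i ∧ nth w i < nth w k)) ∧
    (∀ i j l, i < j → j + 1 < l → l < w.length →
      ¬ (nth w (j + 1) < nth w i ∧ nth w i < nth w l ∧ nth w l < nth w j)) := by
  simp only [Avoids, contains3142_iff, contains2413_iff, not_exists, not_and]

theorem IsPerm.length {n : ℕ} {w : List ℕ} (h : IsPerm n w) : w.length = n := by
  simpa using List.Perm.length_eq h

theorem IsPerm.nodup {n : ℕ} {w : List ℕ} (h : IsPerm n w) : w.Nodup :=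
  (List.Perm.nodup_iff h).2 (List.nodup_range' ..)

theorem IsPerm.mem_iff {n : ℕ} {w : List ℕ} (h : IsPerm n w) {x : ℕ} :
    x ∈ w ↔ 1 ≤ x ∧ x ≤ n := by
  rw [List.Perm.mem_iff h, List.mem_range'_1]; omega

theorem isPerm_of_nodup {n : ℕ} {w : List ℕ} (h : w.Nodup)
    (hm : ∀ x, x ∈ w ↔ 1 ≤ x ∧ x ≤ n) : IsPerm n w := by
  refine (List.perm_ext_iff_of_nodup h (List.nodup_range' ..)).2 fun x => ?_
  rw [hm, List.mem_range'_1]; omega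

theorem isPerm_of_length {n : ℕ} {w : List ℕ} (h : w.Nodup) (hl : w.length = n)
    (hm : ∀ x ∈ w, 1 ≤ x ∧ x ≤ n) : IsPerm n w := by
  have hs : w.toFinset = Finset.Icc 1 n := by
    apply Finset.eq_of_subset_of_card_le
    · intro x hx
      simpa using hm x (by simpa using hx)
    · rw [List.toFinset_card_of_nodup h]; simp [hl]
  refine isPerm_of_nodup h fun x => ?_
  rw [← List.mem_toFinset, hs, Finset.mem_Icc]

theorem avoids_map {w : List ℕ} {F : ℕ → ℕ} (hF : StrictMonoOn F {x | x ∈ w}) :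
    Avoids (w.map F) ↔ Avoids w := by
  have key : ∀ i j, i < w.length → j < w.length →
      (nth (w.map F) i < nth (w.map F) j ↔ nth w i < nth w j) := by
    intro i j hi hj
    rw [nth_map F w hi, nth_map F w hj]
    exact hF.lt_iff_lt (nth_mem hi) (nth_mem hj)
  simp only [avoids_iff, List.length_map]
  constructor
  · rintro ⟨h1, h2⟩
    refine ⟨fun i j k l hij hjk hkl hl => ?_, fun i j l hij hjl hl => ?_⟩
    · have := h1 i j k l hij hjk hkl hl
      rwa [key _ _ (by omega) (by omega), key _ _ (by omega) (by omega),
        key _ _ (by omega) (by omega)] at this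
    · have := h2 i j l hij hjl hl
      rwa [key _ _ (by omega) (by omega), key _ _ (by omega) (by omega),
        key _ _ (by omega) (by omega)] at this
  · rintro ⟨h1, h2⟩
    refine ⟨fun i j k l hij hjk hkl hl => ?_, fun i j l hij hjl hl => ?_⟩
    · have := h1 i j k l hij hjk hkl hl
      rwa [key _ _ (by omega) (by omega), key _ _ (by omega) (by omega),
        key _ _ (by omega) (by omega)]
    · have := h2 i j l hij hjl hl
      rwa [key _ _ (by omega) (by omega), key _ _ (by omega) (by omega),
        key _ _ (by omega) (by omega)]

theorem Avoids.of_append_left {u v : List ℕ} (h : Avoids (u ++ v)) : Avoids u := by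
  rw [avoids_iff] at h ⊢
  obtain ⟨h1, h2⟩ := h
  rw [List.length_append] at h1 h2
  refine ⟨fun i j k l hij hjk hkl hl => ?_, fun i j l hij hjl hl => ?_⟩
  · have := h1 i j k l hij hjk hkl (by omega)
    rwa [nth_append_left _ _ (by omega), nth_append_left _ _ (by omega),
      nth_append_left _ _ (by omega), nth_append_left _ _ (by omega)] at this
  · have := h2 i j l hij hjl (by omega)
    rwa [nth_append_left _ _ (by omega), nth_append_left _ _ (by omega),
      nth_append_left _ _ (by omega), nth_append_left _ _ (by omega)] at this

theorem nth_append_add (u v : List ℕ) (i : ℕ) : nth (u ++ v) (u.length + i) = nth v i := by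
  rw [nth_append_right _ _ (by omega)]; congr 1; omega

theorem Avoids.of_append_right {u v : List ℕ} (h : Avoids (u ++ v)) : Avoids v := by
  rw [avoids_iff] at h ⊢
  obtain ⟨h1, h2⟩ := h
  rw [List.length_append] at h1 h2
  refine ⟨fun i j k l hij hjk hkl hl => ?_, fun i j l hij hjl hl => ?_⟩
  · have := h1 (u.length + i) (u.length + j) (u.length + k) (u.length + l) (by omega) (by omega)
      (by omega) (by omega)
    simpa only [nth_append_add] using this
  · have := h2 (u.length + i) (u.length + j) (u.length + l) (by omega) (by omega) (by omega)
    rw [add_assoc] at this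
    simpa only [nth_append_add] using this

theorem Avoids.append {u v : List ℕ} (hu : Avoids u) (hv : Avoids v)
    (huv : ∀ x ∈ u, ∀ y ∈ v, x < y) : Avoids (u ++ v) := by
  have key : ∀ i j, j < (u ++ v).length → i < u.length → u.length ≤ j →
      nth (u ++ v) i < nth (u ++ v) j := by
    intro i j hj hi hj'
    rw [nth_append_left _ _ hi, nth_append_right _ _ hj']
    rw [List.length_append] at hj
    exact huv _ (nth_mem hi) _ (nth_mem (by omega))
  rw [avoids_iff] at hu hv ⊢
  refine ⟨fun i j k l hij hjk hkl hl H => ?_, fun i j l hij hjl hl H => ?_⟩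
  · by_cases h1 : l < u.length
    · rw [nth_append_left _ _ (by omega), nth_append_left _ _ (by omega),
        nth_append_left _ _ (by omega), nth_append_left _ _ (by omega)] at H
      exact hu.1 i j k l hij hjk hkl h1 H
    by_cases h2 : i < u.length
    · have := key i l hl h2 (by omega)
      omega
    · rw [nth_append_right _ _ (by omega), nth_append_right _ _ (by omega),
        nth_append_right _ _ (by omega), nth_append_right _ _ (by omega)] at H
      rw [List.length_append] at hl
      exact hv.1 _ _ _ _ (by omega) (by omega) (by omega) (by omega) H
  · by_cases h1 : l < u.length
    · rw [nth_append_left _ _ (by omega), nth_append_left _ _ (by omega),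
        nth_append_left _ _ (by omega), nth_append_left _ _ (by omega)] at H
      exact hu.2 i j l hij hjl h1 H
    by_cases h2 : i < u.length
    · by_cases h3 : j < u.length
      · have := key j l hl h3 (by omega)
        omega
      · have := key i (j + 1) (by omega) h2 (by omega)
        omega
    · rw [nth_append_right _ _ (by omega), nth_append_right _ _ (by omega),
        nth_append_right _ _ (by omega), nth_append_right _ _ (by omega)] at H
      rw [List.length_append] at hl
      refine hv.2 (i - u.length) (j - u.length) (l - u.length) (by omega) (by omega)
        (by omega) ?_
      rwa [show j - u.length + 1 = j + 1 - u.length by omega]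

theorem avoids_nil : Avoids [] := by
  rw [avoids_iff]; simp

/-! Recursions for the statistics. -/

theorem asc_nil : asc [] = 0 := by simp [asc]

theorem asc_eq (w : List ℕ) :
    asc w = ((Finset.range (w.length - 1)).filter fun i => nth w i < nth w (i + 1)).card := by
  unfold asc
  refine Finset.card_bij (fun p _ => (p.1 : ℕ)) ?_ ?_ ?_
  · rintro ⟨i, j⟩ hp
    simp only [Finset.mem_filter, Finset.mem_univ, true_and, Finset.mem_range] at hp ⊢
    have := j.2
    refine ⟨by omega, ?_⟩
    rw [hp.1, nth_eq_get, nth_eq_get]; exact hp.2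
  · rintro ⟨i, j⟩ hp ⟨i', j'⟩ hp' e
    simp only [Finset.mem_filter, Finset.mem_univ, true_and] at hp hp'
    simp only at e
    ext <;> simp <;> omega
  · intro i hi
    simp only [Finset.mem_filter, Finset.mem_range] at hi
    refine ⟨(⟨i, by omega⟩, ⟨i + 1, by omega⟩), ?_, rfl⟩
    simp only [Finset.mem_filter, Finset.mem_univ, true_and]
    rw [← nth_eq_get, ← nth_eq_get]; exact hi.2

theorem des_eq (w : List ℕ) :
    des w = ((Finset.range (w.length - 1)).filter fun i => nth w (i + 1) < nth w i).card := by
  unfold des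
  refine Finset.card_bij (fun p _ => (p.1 : ℕ)) ?_ ?_ ?_
  · rintro ⟨i, j⟩ hp
    simp only [Finset.mem_filter, Finset.mem_univ, true_and, Finset.mem_range] at hp ⊢
    have := j.2
    refine ⟨by omega, ?_⟩
    rw [hp.1, nth_eq_get, nth_eq_get]; exact hp.2
  · rintro ⟨i, j⟩ hp ⟨i', j'⟩ hp' e
    simp only [Finset.mem_filter, Finset.mem_univ, true_and] at hp hp'
    simp only at e
    ext <;> simp <;> omega
  · intro i hi
    simp only [Finset.mem_filter, Finset.mem_range] at hi
    refine ⟨(⟨i, by omega⟩, ⟨i + 1, by omega⟩), ?_, rfl⟩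
    simp only [Finset.mem_filter, Finset.mem_univ, true_and]
    rw [← nth_eq_get, ← nth_eq_get]; exact hi.2

/-- Only ascents are followed through the bijection; descents enter at the end through this
identity. -/
theorem asc_add_des {w : List ℕ} (hw : w.Nodup) : asc w + des w = w.length - 1 := by
  have := Finset.card_filter_add_card_filter_not (s := Finset.range (w.length - 1))
    (fun i => nth w i < nth w (i + 1))
  rw [Finset.card_range] at this
  rw [asc_eq, des_eq]
  refine Eq.trans ?_ this
  congr 2
  apply Finset.filter_congr
  intro i hi
  rw [Finset.mem_range] at hi
  have : nth w i ≠ nth w (i + 1) := fun h => by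
    have := nth_inj hw (by omega) (by omega) h
    omega
  omega

theorem asc_map {w : List ℕ} {F : ℕ → ℕ} (hF : StrictMonoOn F {x | x ∈ w}) :
    asc (w.map F) = asc w := by
  rw [asc_eq, asc_eq, List.length_map]
  congr 1
  apply Finset.filter_congr
  intro i hi
  rw [Finset.mem_range] at hi
  rw [nth_map F w (by omega), nth_map F w (by omega)]
  exact hF.lt_iff_lt (nth_mem (by omega)) (nth_mem (by omega))

theorem asc_append {u v : List ℕ} (hu : u ≠ []) (hv : v ≠ []) :
    asc (u ++ v) = asc u + asc v + if u.getLast hu < v.head hv then 1 else 0 := by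
  have hul := List.length_pos_iff.2 hu
  have hvl := List.length_pos_iff.2 hv
  have hlast : u.getLast hu = nth u (u.length - 1) := by
    rw [nth_eq_getElem _ (by omega), List.getLast_eq_getElem]
  have hhead : v.head hv = nth v 0 := by
    rw [nth_eq_getElem _ (by omega), List.head_eq_getElem]
  simp only [asc_eq, Finset.card_filter]
  rw [List.length_append,
    show u.length + v.length - 1 = u.length - 1 + (1 + (v.length - 1)) by omega,
    Finset.sum_range_add, Finset.sum_range_add, Finset.sum_range_one]
  have e1 : ∀ i ∈ Finset.range (u.length - 1),
      (if nth (u ++ v) i < nth (u ++ v) (i + 1) then 1 else 0)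
        = if nth u i < nth u (i + 1) then 1 else 0 := by
    intro i hi
    rw [Finset.mem_range] at hi
    rw [nth_append_left _ _ (by omega), nth_append_left _ _ (by omega)]
  have e2 : ∀ i ∈ Finset.range (v.length - 1),
      (if nth (u ++ v) (u.length - 1 + (1 + i)) < nth (u ++ v) (u.length - 1 + (1 + i) + 1)
        then 1 else 0) = if nth v i < nth v (i + 1) then 1 else 0 := by
    intro i _
    rw [show u.length - 1 + (1 + i) = u.length + i by omega, add_assoc, nth_append_add,
      nth_append_add]
  rw [Finset.sum_congr rfl e1, Finset.sum_congr rfl e2, hlast, hhead, add_zero,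
    nth_append_left _ _ (by omega), show u.length - 1 + 1 = u.length + 0 by omega,
    nth_append_add]
  ring

theorem asc_singleton (a : ℕ) : asc [a] = 0 := by simp [asc_eq]

theorem rmax_nil : rmax [] = 0 := by simp [rmax]

theorem rmax_cons (a : ℕ) (l : List ℕ) :
    rmax (a :: l) = (if ∀ x ∈ l, x ≤ a then 1 else 0) + rmax l := by
  unfold rmax
  refine (Fin.card_filter_univ_succ (n := l.length) fun i : Fin (l.length + 1) =>
    ∀ j : Fin (a :: l).length, i < j → (a :: l).get j ≤ (a :: l).get i).trans ?_
  have e0 : (∀ j : Fin (a :: l).length, 0 < j → (a :: l).get j ≤ (a :: l).get 0) ↔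
      ∀ x ∈ l, x ≤ a := by
    constructor
    · intro h x hx
      obtain ⟨i, hi, rfl⟩ := List.mem_iff_getElem.1 hx
      simpa using h ⟨i + 1, by simpa using hi⟩ (by simp [Fin.lt_def])
    · intro h j hj
      obtain ⟨j, rfl⟩ := Fin.exists_succ_eq.2 (Fin.pos_iff_ne_zero.1 hj)
      simpa using h _ (List.getElem_mem j.2)
  have e1 : ∀ i : Fin l.length,
      (∀ j : Fin (a :: l).length, i.succ < j → (a :: l).get j ≤ (a :: l).get i.succ) ↔
      ∀ j : Fin l.length, i < j → l.get j ≤ l.get i := by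
    intro i
    constructor
    · intro h j hj
      simpa using h j.succ (Fin.succ_lt_succ_iff.2 hj)
    · intro h j hj
      obtain ⟨j, rfl⟩ := Fin.exists_succ_eq.2 (Fin.pos_iff_ne_zero.1 (lt_trans (Fin.succ_pos i) hj))
      simpa using h j (Fin.succ_lt_succ_iff.1 hj)
  simp only [e1]
  by_cases h : ∀ x ∈ l, x ≤ a
  · rw [if_pos (e0.2 h), if_pos h, add_comm]
  · rw [if_neg (fun H => h (e0.1 H)), if_neg h, zero_add]

theorem lmax_eq_rmax_reverse (w : List ℕ) : lmax w = rmax w.reverse := by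
  unfold lmax rmax
  refine Finset.card_bij (fun i _ => ⟨w.length - 1 - i, by have := i.2; simp; omega⟩) ?_ ?_ ?_
  · intro i hi
    simp only [Finset.mem_filter, Finset.mem_univ, true_and] at hi ⊢
    intro j hj
    have hj2 := j.2
    have hi2 := i.2
    simp only [Fin.lt_def, List.length_reverse] at hj hj2
    have := hi ⟨w.length - 1 - j, by omega⟩ (by simp only [Fin.lt_def]; omega)
    simp only [List.get_eq_getElem, List.getElem_reverse] at this ⊢
    convert this using 2
    omega
  · intro i _ j _ e
    have := i.2
    have := j.2
    simp only [Fin.mk.injEq] at e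
    ext; omega
  · intro i hi
    have hi2 := i.2
    simp only [List.length_reverse] at hi2
    refine ⟨⟨w.length - 1 - i, by omega⟩, ?_, by ext; simp; omega⟩
    simp only [Finset.mem_filter, Finset.mem_univ, true_and] at hi ⊢
    intro j hj
    have hj2 := j.2
    simp only [Fin.lt_def] at hj
    have := hi ⟨w.length - 1 - j, by simp; omega⟩ (by simp only [Fin.lt_def]; omega)
    simp only [List.get_eq_getElem, List.getElem_reverse] at this ⊢
    convert this using 2
    omega

theorem rmax_append_of_lt {u v : List ℕ} (h : ∀ x ∈ u, ∃ y ∈ v, x < y) :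
    rmax (u ++ v) = rmax v := by
  induction u with
  | nil => rfl
  | cons a u ih =>
    rw [List.cons_append, rmax_cons, ih fun x hx => h x (by simp [hx])]
    obtain ⟨y, hy, hay⟩ := h a (by simp)
    rw [if_neg fun H => absurd (H y (by simp [hy])) (by omega), zero_add]

theorem rmax_append_of_gt {u v : List ℕ} (h : ∀ x ∈ u, ∀ y ∈ v, y < x) :
    rmax (u ++ v) = rmax u + rmax v := by
  induction u with
  | nil => simp [rmax_nil]
  | cons a u ih =>
    rw [List.cons_append, rmax_cons, rmax_cons, ih fun x hx => h x (by simp [hx]), add_assoc]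
    congr 1
    refine if_congr ⟨fun H x hx => H x (by simp [hx]), fun H x hx => ?_⟩ rfl rfl
    rcases List.mem_append.1 hx with hx | hx
    · exact H x hx
    · exact (h a (by simp) x hx).le

theorem rmax_cons_max {a : ℕ} {l : List ℕ} (h : ∀ x ∈ l, x < a) : rmax (a :: l) = 1 + rmax l := by
  rw [rmax_cons, if_pos fun x hx => (h x hx).le]

theorem rmax_map {w : List ℕ} {F : ℕ → ℕ} (hF : StrictMonoOn F {x | x ∈ w}) :
    rmax (w.map F) = rmax w := by
  induction w with
  | nil => rfl
  | cons a w ih =>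
    rw [List.map_cons, rmax_cons, rmax_cons, ih (hF.mono fun x hx => by simp_all)]
    congr 1
    refine if_congr ?_ rfl rfl
    rw [List.forall_mem_map]
    refine forall₂_congr fun x hx => ?_
    exact hF.le_iff_le (by simp [hx]) (by simp)

theorem lmax_map {w : List ℕ} {F : ℕ → ℕ} (hF : StrictMonoOn F {x | x ∈ w}) :
    lmax (w.map F) = lmax w := by
  rw [lmax_eq_rmax_reverse, lmax_eq_rmax_reverse, ← List.map_reverse, rmax_map]
  simpa using hF

theorem lmax_append {u v : List ℕ} (h : ∀ x ∈ u, ∀ y ∈ v, x < y) :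
    lmax (u ++ v) = lmax u + lmax v := by
  simp only [lmax_eq_rmax_reverse, List.reverse_append]
  rw [rmax_append_of_gt (by simpa using fun x hx y hy => h y hy x hx), add_comm]

theorem lmax_append_max {u v : List ℕ} {a : ℕ} (hu : ∀ x ∈ u, x < a) (hv : ∀ x ∈ v, x < a) :
    lmax (u ++ a :: v) = lmax u + 1 := by
  simp only [lmax_eq_rmax_reverse, List.reverse_append, List.reverse_cons, List.append_assoc]
  rw [rmax_append_of_lt, List.singleton_append, rmax_cons_max (by simpa using hu), add_comm]
  intro x hx
  exact ⟨a, by simp, hv x (by simpa using hx)⟩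

end PermWord

-- Allowed levels of a permutation that starts with its largest letter.

namespace PermWord

/-- Letters with exactly `ℓ` letters of `w` below them may be put in front of `w` without
creating a forbidden pattern with a single letter in front of `w`. -/
def Allowed (w : List ℕ) (ℓ : ℕ) : Prop :=
  (∀ i j k, i < j → j < k → k < w.length → ¬ (nth w i < nth w k ∧ nth w k ≤ ℓ ∧ ℓ < nth w j)) ∧
  (∀ i k, i + 1 < k → k < w.length →
    ¬ (nth w (i + 1) ≤ ℓ ∧ ℓ < nth w k ∧ nth w k < nth w i))

theorem nth_le {M : ℕ} {w : List ℕ} (h : IsPerm M w) (i : ℕ) : nth w i ≤ M := by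
  by_cases hi : i < w.length
  · exact (h.mem_iff.1 (nth_mem hi)).2
  · simp [nth, not_lt.1 hi]

theorem one_le_nth {M : ℕ} {w : List ℕ} (h : IsPerm M w) {i : ℕ} (hi : i < w.length) :
    1 ≤ nth w i :=
  (h.mem_iff.1 (nth_mem hi)).1

theorem nth_lt_of_head {M : ℕ} {w : List ℕ} (h : IsPerm M w) (h0 : nth w 0 = M) {i : ℕ}
    (hi : 0 < i) (hi2 : i < w.length) : nth w i < M := by
  refine lt_of_le_of_ne (nth_le h i) fun e => ?_
  have := nth_inj h.nodup hi2 (by omega) (e.trans h0.symm)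
  omega

theorem allowed_zero {M : ℕ} {w : List ℕ} (h : IsPerm M w) : Allowed w 0 := by
  refine ⟨fun i j k _ _ hk H => by omega, fun i k hik hk H => ?_⟩
  have := one_le_nth h (i := i + 1) (by omega)
  omega

/-- Either forbidden configuration needs a letter above `ℓ` in a position other than the first. In
particular `M - 1` is allowed, so every smaller level has an allowed successor below `M`. -/
theorem allowed_of_le {M : ℕ} {w : List ℕ} (h : IsPerm M w) (h0 : nth w 0 = M) {ℓ : ℕ}
    (hℓ : M - 1 ≤ ℓ) : Allowed w ℓ := by
  refine ⟨fun i j k hij hjk hk H => ?_, fun i k hik hk H => ?_⟩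
  · have := nth_lt_of_head h h0 (i := j) (by omega) (by omega)
    omega
  · have := nth_lt_of_head h h0 (i := k) (by omega) (by omega)
    omega

/-- A discrete intermediate value argument; it produces the adjacent letters 41 of a pattern 2-41-3.
-/
theorem exists_descent {w : List ℕ} {ℓ : ℕ} : ∀ {a b : ℕ}, a < b → ℓ < nth w a → nth w b ≤ ℓ →
    ∃ i, a ≤ i ∧ i < b ∧ ℓ < nth w i ∧ nth w (i + 1) ≤ ℓ := by
  intro a b hab ha hb
  induction b, hab using Nat.le_induction with
  | base => exact ⟨a, le_rfl, by omega, ha, hb⟩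
  | succ b hab ih =>
    by_cases h : nth w b ≤ ℓ
    · obtain ⟨i, h1, h2, h3⟩ := ih h
      exact ⟨i, h1, by omega, h3⟩
    · exact ⟨b, by omega, by omega, by omega, hb⟩

/-- If `ℓ` is allowed then all letters in front of the letter `ℓ + 1` are larger. -/
theorem Allowed.lt_of_before {M : ℕ} {w : List ℕ} (h : IsPerm M w) (h0 : nth w 0 = M) {ℓ p : ℕ}
    (hℓ : Allowed w ℓ) (hM : ℓ + 1 < M) (hp : p < w.length) (hpv : nth w p = ℓ + 1) {i : ℕ}
    (hi : i < p) : ℓ + 1 < nth w i := by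
  by_contra hc
  have hne : nth w i ≠ ℓ + 1 := fun e => by
    have := nth_inj h.nodup (by omega) hp (e.trans hpv.symm)
    omega
  have hi0 : 0 < i := Nat.pos_of_ne_zero fun e => by subst e; omega
  -- The word starts with `M > ℓ`, so on the way to a letter at most `ℓ` it drops across `ℓ` between
  -- neighbours. With the later letter `ℓ + 1` these form a 41-3 that excludes the level `ℓ`.
  obtain ⟨j, _, hj, hj1, hj2⟩ := exists_descent (w := w) (ℓ := ℓ) hi0 (by omega) (by omega)
  have hne : nth w j ≠ ℓ + 1 := fun e => by
    have := nth_inj h.nodup (by omega) hp (e.trans hpv.symm)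
    omega
  exact hℓ.2 j p (by omega) hp ⟨hj2, by omega, by omega⟩

/-- The level just below the smallest letter in front of `ℓ + 1` is the next allowed one. -/
theorem Allowed.next {M : ℕ} {w : List ℕ} (h : IsPerm M w) (h0 : nth w 0 = M) (hw : Avoids w)
    {ℓ p q v : ℕ} (hℓ : Allowed w ℓ) (hM : ℓ + 1 < M) (hp : p < w.length) (hpv : nth w p = ℓ + 1)
    (hv : v < p) (hvq : nth w v = q + 1) (hmin : ∀ i < p, q + 1 ≤ nth w i) :
    Allowed w q ∧ ∀ m, ℓ < m → m < q → ¬ Allowed w m := by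
  have hbef : ∀ i < p, ℓ + 1 < nth w i := fun i hi => hℓ.lt_of_before h h0 hM hp hpv hi
  have inj : ∀ i j, i < w.length → j < w.length → nth w i = nth w j → i = j :=
    fun i j hi hj => nth_inj h.nodup hi hj
  rw [avoids_iff] at hw
  have hvℓ := hbef v hv
  refine ⟨⟨fun x y z hxy hyz hz H => ?_, fun y z hyz hz H => ?_⟩, fun m hm hmq hA => ?_⟩
  · have hxp : p ≤ x := by
      by_contra hc
      have := hmin x (by omega)
      omega
    -- If the letter at `z` exceeds `ℓ + 1`, then `v p y z` is a 3-1-4-2 in `w`. Otherwise it is at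
    -- most `ℓ`, and `x y z` already excludes the level `ℓ`.
    rcases Nat.lt_or_ge (ℓ + 1) (nth w z) with hz' | hz'
    · have hyp : nth w y ≠ nth w v := fun e => by
        have := inj _ _ (by omega) (by omega) e
        omega
      exact hw.1 v p y z hv (by omega) hyz hz ⟨by omega, by omega, by omega⟩
    · have hzp : nth w z ≠ nth w p := fun e => by
        have := inj _ _ (by omega) (by omega) e
        omega
      exact hℓ.1 x y z hxy hyz hz ⟨H.1, by omega, by omega⟩
  · have hxp : p ≤ y + 1 := by
      by_contra hc
      have := hmin (y + 1) (by omega)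
      omega
    have hzv : nth w z ≠ nth w v := fun e => by
      have := inj _ _ (by omega) (by omega) e
      omega
    rcases Nat.lt_or_ge v y with hvy | hvy
    · exact hw.2 v y z hvy hyz hz ⟨by omega, by omega, by omega⟩
    · have : v = y := by omega
      subst this
      omega
  · obtain ⟨z, hz, hzv⟩ := mem_iff_nth.1 (h.mem_iff.2 (⟨by omega, by
      have := nth_le h v
      omega⟩ : 1 ≤ m + 1 ∧ m + 1 ≤ M))
    have hzp : p < z := by
      by_contra hc
      rcases Nat.lt_or_ge z p with hzp | hzp
      · have := hmin z hzp
        omega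
      · have : z = p := by omega
        subst this
        omega
    -- The letter `m + 1` lies behind position `p`, and between `v` and `p` the word drops across
    -- `m`: this 41-3 excludes `m`.
    obtain ⟨j, _, hj, hj1, hj2⟩ := exists_descent (w := w) (ℓ := m) hv (by omega) (by omega)
    have hne : nth w j ≠ m + 1 := fun e => by
      have := inj _ _ (by omega) hz (e.trans hzv.symm)
      omega
    exact hA.2 j z (by omega) hz ⟨hj2, by omega, by omega⟩

/-- The least allowed level above `ℓ`. -/
noncomputable def succLevel (w : List ℕ) (ℓ : ℕ) : ℕ := sInf {m | ℓ < m ∧ Allowed w m}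

open Classical in
/-- The largest allowed level below `ℓ`. -/
noncomputable def predLevel (w : List ℕ) (ℓ : ℕ) : ℕ := Nat.findGreatest (Allowed w) (ℓ - 1)

theorem succLevel_spec {M : ℕ} {w : List ℕ} (h : IsPerm M w) (h0 : nth w 0 = M) (ℓ : ℕ) :
    ℓ < succLevel w ℓ ∧ Allowed w (succLevel w ℓ) :=
  Nat.sInf_mem (s := {m | ℓ < m ∧ Allowed w m})
    ⟨ℓ + 1 + M, by omega, allowed_of_le h h0 (by omega)⟩

theorem succLevel_le {w : List ℕ} {ℓ m : ℕ} (hm : ℓ < m) (h : Allowed w m) :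
    succLevel w ℓ ≤ m := Nat.sInf_le ⟨hm, h⟩

theorem succLevel_mono {M : ℕ} {w : List ℕ} (h : IsPerm M w) (h0 : nth w 0 = M) :
    Monotone (succLevel w) := fun _ b hab =>
  succLevel_le (lt_of_le_of_lt hab (succLevel_spec h h0 b).1) (succLevel_spec h h0 b).2

theorem succLevel_lt {M : ℕ} {w : List ℕ} (h : IsPerm M w) (h0 : nth w 0 = M) {ℓ : ℕ}
    (hℓ : ℓ + 1 < M) : succLevel w ℓ < M := by
  have := succLevel_le (w := w) (ℓ := ℓ) (m := M - 1) (by omega) (allowed_of_le h h0 le_rfl)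
  omega

theorem succLevel_inj {M : ℕ} {w : List ℕ} (h : IsPerm M w) (h0 : nth w 0 = M) {a b : ℕ}
    (ha : Allowed w a) (hb : Allowed w b) (hab : succLevel w a = succLevel w b) : a = b := by
  have h1 := (succLevel_spec h h0 a).1
  have h2 := (succLevel_spec h h0 b).1
  rcases lt_trichotomy a b with hlt | rfl | hlt
  · have := succLevel_le hlt hb
    omega
  · rfl
  · have := succLevel_le hlt ha
    omega

open Classical in
theorem predLevel_mono (w : List ℕ) : Monotone (predLevel w) := fun a b hab =>
  Nat.findGreatest_mono_right _ (by omega)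

open Classical in
theorem predLevel_allowed {M : ℕ} {w : List ℕ} (h : IsPerm M w) (ℓ : ℕ) :
    Allowed w (predLevel w ℓ) := by
  unfold predLevel
  apply Nat.findGreatest_spec (P := Allowed w) (Nat.zero_le _) (allowed_zero h)

open Classical in
theorem predLevel_lt {w : List ℕ} {ℓ : ℕ} (hℓ : 0 < ℓ) : predLevel w ℓ < ℓ := by
  have : predLevel w ℓ ≤ ℓ - 1 := by
    unfold predLevel
    apply Nat.findGreatest_le
  omega

open Classical in
theorem le_predLevel {w : List ℕ} {ℓ m : ℕ} (hm : m < ℓ) (h : Allowed w m) :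
    m ≤ predLevel w ℓ := by
  unfold predLevel
  apply Nat.le_findGreatest (by omega) h

theorem succLevel_predLevel {M : ℕ} {w : List ℕ} (h : IsPerm M w) (h0 : nth w 0 = M) {ℓ : ℕ}
    (hℓ : Allowed w ℓ) (hpos : 0 < ℓ) : succLevel w (predLevel w ℓ) = ℓ := by
  have h1 := succLevel_le (predLevel_lt (w := w) hpos) hℓ
  have h2 := succLevel_spec h h0 (predLevel w ℓ)
  rcases h1.lt_or_eq with h3 | h3
  · have := le_predLevel h3 h2.2
    omega
  · exact h3

/-- This reads the next allowed level off the word, as the smallest letter in front of `ℓ + 1`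
diminished by one. It links the abstract successor with the count made by `mCount`. -/
theorem succLevel_before {M : ℕ} {w : List ℕ} (h : IsPerm M w) (h0 : nth w 0 = M) (hw : Avoids w)
    {ℓ p : ℕ} (hℓ : Allowed w ℓ) (hM : ℓ + 1 < M) (hp : p < w.length) (hpv : nth w p = ℓ + 1) :
    (∀ i < p, succLevel w ℓ < nth w i) ∧ ∃ v < p, nth w v = succLevel w ℓ + 1 := by
  have hp0 : 0 < p := Nat.pos_of_ne_zero fun e => by subst e; omega
  obtain ⟨v, hv, hmin⟩ := Finset.exists_min_image (Finset.range p) (nth w)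
    ⟨0, Finset.mem_range.2 hp0⟩
  simp only [Finset.mem_range] at hv hmin
  have hvℓ := hℓ.lt_of_before h h0 hM hp hpv hv
  obtain ⟨q, hq⟩ : ∃ q, nth w v = q + 1 := ⟨nth w v - 1, by omega⟩
  obtain ⟨hqA, hqm⟩ := hℓ.next h h0 hw hM hp hpv hv hq (fun i hi => hq ▸ hmin i hi)
  have hs : succLevel w ℓ = q := by
    have h1 := succLevel_le (w := w) (ℓ := ℓ) (m := q) (by omega) hqA
    have h2 := succLevel_spec h h0 ℓ
    rcases h1.lt_or_eq with h3 | h3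
    · exact absurd h2.2 (hqm _ h2.1 h3)
    · exact h3
  rw [hs]
  exact ⟨fun i hi => by have := hmin i hi; omega, v, hv, hq⟩

end PermWord

namespace PermWord

/-! Permutations whose front part and rear part have prescribed patterns. -/

/-- The letter of rank `r` of the front part, if `g r` letters of the rear part are below it. -/
def lower (g : ℕ → ℕ) (r : ℕ) : ℕ := r + g r

/-- The letter of rank `q` of the rear part, if the front part has `s` letters, and `g r` letters
of the rear part are below the front letter of rank `r`. -/
def upper (g : ℕ → ℕ) (s q : ℕ) : ℕ := q + ((Finset.Icc 1 s).filter fun r => g r < q).card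

/-- The word with front pattern `ρ` and rear pattern `w` whose front letter of rank `r` has
exactly `g r` rear letters below it. -/
def build (g : ℕ → ℕ) (ρ w : List ℕ) : List ℕ :=
  ρ.map (lower g) ++ w.map (upper g ρ.length)

theorem lower_strictMono {g : ℕ → ℕ} (hg : Monotone g) : StrictMono (lower g) := fun a b hab => by
  have := hg hab.le
  unfold lower; omega

theorem upper_strictMono (g : ℕ → ℕ) (s : ℕ) : StrictMono (upper g s) := fun a b hab => by
  have : ((Finset.Icc 1 s).filter fun r => g r < a).card ≤
      ((Finset.Icc 1 s).filter fun r => g r < b).card :=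
    Finset.card_le_card (Finset.monotone_filter_right _ fun r _ h => lt_trans h hab)
  unfold upper; omega

/-- By monotonicity all ranks `1, …, r` have level below `q`, so `upper g s q` is at least `q + r`.
In the opposite case only ranks smaller than `r` are counted. Comparing a front letter with a rear
letter thus amounts to comparing a level with a rank. -/
theorem lower_lt_upper {g : ℕ → ℕ} (hg : Monotone g) {s r q : ℕ} (hr : r ≤ s) (h : g r < q) :
    lower g r < upper g s q := by
  have : (Finset.Icc 1 r).card ≤ ((Finset.Icc 1 s).filter fun r => g r < q).card := by
    apply Finset.card_le_card
    intro x hx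
    simp only [Finset.mem_Icc, Finset.mem_filter] at hx ⊢
    have := hg hx.2
    omega
  rw [Nat.card_Icc] at this
  unfold lower upper; omega

theorem upper_lt_lower {g : ℕ → ℕ} (hg : Monotone g) {s r q : ℕ} (hr : 1 ≤ r) (h : q ≤ g r) :
    upper g s q < lower g r := by
  have : ((Finset.Icc 1 s).filter fun r => g r < q).card ≤ (Finset.Icc 1 (r - 1)).card := by
    apply Finset.card_le_card
    intro x hx
    simp only [Finset.mem_Icc, Finset.mem_filter] at hx ⊢
    by_contra hc
    have := hg (show r ≤ x by omega)
    omega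
  rw [Nat.card_Icc] at this
  unfold lower upper; omega

theorem lower_lt_upper_iff {g : ℕ → ℕ} (hg : Monotone g) {s r q : ℕ} (h1 : 1 ≤ r) (hr : r ≤ s) :
    lower g r < upper g s q ↔ g r < q := by
  refine ⟨fun h => ?_, lower_lt_upper hg hr⟩
  by_contra hc
  have := upper_lt_lower hg (s := s) h1 (not_lt.1 hc)
  omega

theorem upper_lt_lower_iff {g : ℕ → ℕ} (hg : Monotone g) {s r q : ℕ} (h1 : 1 ≤ r) (hr : r ≤ s) :
    upper g s q < lower g r ↔ q ≤ g r := by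
  refine ⟨fun h => ?_, upper_lt_lower hg h1⟩
  by_contra hc
  have := lower_lt_upper hg hr (not_le.1 hc)
  omega

theorem lower_ne_upper {g : ℕ → ℕ} (hg : Monotone g) {s r q : ℕ} (h1 : 1 ≤ r) (hr : r ≤ s) :
    lower g r ≠ upper g s q := by
  rcases Nat.lt_or_ge (g r) q with h | h
  · exact (lower_lt_upper hg hr h).ne
  · exact (upper_lt_lower hg h1 h).ne'

theorem upper_le (g : ℕ → ℕ) (s q : ℕ) : upper g s q ≤ q + s := by
  have := Finset.card_filter_le (Finset.Icc 1 s) fun r => g r < q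
  rw [Nat.card_Icc] at this
  unfold upper; omega

theorem upper_eq {g : ℕ → ℕ} {s q : ℕ} (h : ∀ r, 1 ≤ r → r ≤ s → g r < q) :
    upper g s q = q + s := by
  unfold upper
  rw [Finset.filter_true_of_mem fun r hr => h r (Finset.mem_Icc.1 hr).1 (Finset.mem_Icc.1 hr).2,
    Nat.card_Icc]
  omega

theorem le_upper (g : ℕ → ℕ) (s q : ℕ) : q ≤ upper g s q := Nat.le_add_right _ _

theorem length_build (g : ℕ → ℕ) (ρ w : List ℕ) : (build g ρ w).length = ρ.length + w.length := by
  simp [build]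

theorem nth_build_left (g : ℕ → ℕ) (ρ w : List ℕ) {i : ℕ} (h : i < ρ.length) :
    nth (build g ρ w) i = lower g (nth ρ i) := by
  rw [build, nth_append_left _ _ (by simpa using h), nth_map _ _ h]

theorem nth_build_right (g : ℕ → ℕ) (ρ w : List ℕ) {i : ℕ} (h : ρ.length ≤ i)
    (hi : i < ρ.length + w.length) :
    nth (build g ρ w) i = upper g ρ.length (nth w (i - ρ.length)) := by
  rw [build, nth_append_right _ _ (by simpa using h), List.length_map, nth_map _ _ (by omega)]

theorem isPerm_build {g : ℕ → ℕ} (hg : Monotone g) {s M : ℕ} {ρ w : List ℕ} (hρ : IsPerm s ρ)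
    (hw : IsPerm M w) (hM : ∀ r, 1 ≤ r → r ≤ s → g r ≤ M) : IsPerm (s + M) (build g ρ w) := by
  have hl := hρ.length
  apply isPerm_of_length
  · unfold build
    rw [List.nodup_append]
    refine ⟨hρ.nodup.map (lower_strictMono hg).injective,
      hw.nodup.map (upper_strictMono g _).injective, ?_⟩
    intro a ha b hb
    obtain ⟨r, hr, rfl⟩ := List.mem_map.1 ha
    obtain ⟨q, hq, rfl⟩ := List.mem_map.1 hb
    rw [hρ.mem_iff] at hr
    exact lower_ne_upper hg hr.1 (by omega)
  · rw [length_build, hl, hw.length]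
  · intro x hx
    rcases List.mem_append.1 hx with hx | hx
    · obtain ⟨r, hr, rfl⟩ := List.mem_map.1 hx
      rw [hρ.mem_iff] at hr
      have := hM r hr.1 hr.2
      unfold lower; omega
    · obtain ⟨q, hq, rfl⟩ := List.mem_map.1 hx
      rw [hw.mem_iff] at hq
      have := upper_le g ρ.length q
      have := le_upper g ρ.length q
      omega

/-- The front letters with different levels come in increasing order. -/
def Blocked (g : ℕ → ℕ) (ρ : List ℕ) : Prop :=
  ∀ i j, i < j → j < ρ.length → nth ρ j < nth ρ i → g (nth ρ i) = g (nth ρ j)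

/-- Sort the occurrences by how many of their letters lie in the front part. With all four letters
on one side they are occurrences in `ρ` or `w`. With one letter in front they are what `Allowed`
excludes at its level. With two or three in front, some front descent is separated by a rear letter,
against `Blocked`, except when the cut falls between the adjacent letters 4 and 1; that cannot
happen because the rear part starts with the maximum. -/
theorem avoids_build {g : ℕ → ℕ} (hg : Monotone g) {s M : ℕ} {ρ w : List ℕ} (hρ : IsPerm s ρ)
    (hw : IsPerm M w) (h0 : nth w 0 = M) (hM : ∀ r, 1 ≤ r → r ≤ s → g r < M) :
    Avoids (build g ρ w) ↔ Avoids ρ ∧ Avoids w ∧ Blocked g ρ ∧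
      ∀ r, 1 ≤ r → r ≤ s → Allowed w (g r) := by
  obtain rfl := hρ.length
  obtain hwl := hw.length
  have hL : ∀ i, i < ρ.length → nth (build g ρ w) i = lower g (nth ρ i) :=
    fun i hi => nth_build_left g ρ w hi
  have hR : ∀ i, i < w.length → nth (build g ρ w) (ρ.length + i) = upper g ρ.length (nth w i) :=
    fun i hi => by rw [nth_build_right g ρ w (by omega) (by omega)]; congr 2; omega
  have hrank : ∀ i, i < ρ.length → 1 ≤ nth ρ i ∧ nth ρ i ≤ ρ.length :=
    fun i hi => hρ.mem_iff.1 (nth_mem hi)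
  have hLR : ∀ i q, i < ρ.length → (lower g (nth ρ i) < upper g ρ.length q ↔ g (nth ρ i) < q) :=
    fun i q hi => lower_lt_upper_iff hg (hrank i hi).1 (hrank i hi).2
  have hRL : ∀ i q, i < ρ.length → (upper g ρ.length q < lower g (nth ρ i) ↔ q ≤ g (nth ρ i)) :=
    fun i q hi => upper_lt_lower_iff hg (hrank i hi).1 (hrank i hi).2
  have hLL : ∀ a b, lower g a < lower g b ↔ a < b := fun a b => (lower_strictMono hg).lt_iff_lt
  have hRR : ∀ a b, upper g ρ.length a < upper g ρ.length b ↔ a < b :=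
    fun a b => (upper_strictMono g _).lt_iff_lt
  constructor
  · intro H
    refine ⟨(avoids_map ((lower_strictMono hg).strictMonoOn _)).1 H.of_append_left,
      (avoids_map ((upper_strictMono g _).strictMonoOn _)).1 H.of_append_right, ?_, ?_⟩
    · intro i j hij hj hlt
      by_contra hne
      have h1 := hg hlt.le
      have h2 := hM _ (hrank i (by omega)).1 (hrank i (by omega)).2
      obtain ⟨x, hx, hxv⟩ := mem_iff_nth.1 (hw.mem_iff.2 (⟨by omega, h2.le⟩ :
        1 ≤ g (nth ρ i) ∧ g (nth ρ i) ≤ M))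
      have hx0 : 0 < x := Nat.pos_of_ne_zero fun e => by subst e; omega
      -- A front descent with different levels is the 31 of a 3-1-4-2: the first rear letter, being
      -- the largest, is the 4, and the rear letter of rank `g (nth ρ i)` is the 2.
      refine (avoids_iff.1 H).1 i j (ρ.length + 0) (ρ.length + x) hij (by omega) (by omega)
        (by rw [length_build]; omega) ?_
      rw [hL i (by omega), hL j hj, hR x hx, hR 0 (by omega), hLR j _ hj, hLR i _ (by omega),
        hRL i _ (by omega)]
      omega
    · intro r hr1 hr2
      obtain ⟨i, hi, rfl⟩ := mem_iff_nth.1 (hρ.mem_iff.2 ⟨hr1, hr2⟩)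
      refine ⟨fun a b c hab hbc hc H' => ?_, fun a c hac hc H' => ?_⟩
      · refine (avoids_iff.1 H).1 i (ρ.length + a) (ρ.length + b) (ρ.length + c) (by omega)
          (by omega) (by omega) (by rw [length_build]; omega) ?_
        rw [hL i hi, hR a (by omega), hR b (by omega), hR c hc, hRR, hRL i _ hi, hLR i _ hi]
        exact H'
      · refine (avoids_iff.1 H).2 i (ρ.length + a) (ρ.length + c) (by omega) (by omega)
          (by rw [length_build]; omega) ?_
        rw [add_assoc, hL i hi, hR a (by omega), hR (a + 1) (by omega), hR c hc, hRR, hRL i _ hi,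
          hLR i _ hi]
        exact H'
  · rintro ⟨Hρ, Hw, HB, HA⟩
    have Hρ' := avoids_iff.1 Hρ
    have Hw' := avoids_iff.1 Hw
    rw [avoids_iff, length_build]
    have hdec : ∀ i, ρ.length ≤ i → ∃ i', i = ρ.length + i' := fun i hi =>
      ⟨i - ρ.length, by omega⟩
    refine ⟨fun i j k l hij hjk hkl hl H => ?_, fun i j l hij hjl hl H => ?_⟩
    · rcases Nat.lt_or_ge i ρ.length with hi | hi
      · rcases Nat.lt_or_ge j ρ.length with hj | hj
        · rcases Nat.lt_or_ge l ρ.length with h4 | h4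
          · rw [hL i hi, hL j hj, hL k (by omega), hL l h4, hLL, hLL, hLL] at H
            exact Hρ'.1 i j k l hij hjk hkl h4 H
          · obtain ⟨l, rfl⟩ := hdec l h4
            obtain ⟨H1, H2, -⟩ := H
            have H3 := lt_trans H1 H2
            rw [hL i hi, hL j hj, hLL] at H3
            rw [hL j hj, hR l (by omega), hLR j _ hj] at H1
            rw [hL i hi, hR l (by omega), hRL i _ hi] at H2
            have := HB i j hij hj H3
            omega
        · obtain ⟨j, rfl⟩ := hdec j hj
          obtain ⟨k, rfl⟩ := hdec k (by omega)
          obtain ⟨l, rfl⟩ := hdec l (by omega)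
          rw [hL i hi, hR j (by omega), hR k (by omega), hR l (by omega), hRR, hRL i _ hi,
            hLR i _ hi] at H
          exact (HA _ (hrank i hi).1 (hrank i hi).2).1 j k l (by omega) (by omega) (by omega) H
      · obtain ⟨i, rfl⟩ := hdec i hi
        obtain ⟨j, rfl⟩ := hdec j (by omega)
        obtain ⟨k, rfl⟩ := hdec k (by omega)
        obtain ⟨l, rfl⟩ := hdec l (by omega)
        rw [hR i (by omega), hR j (by omega), hR k (by omega), hR l (by omega), hRR, hRR,
          hRR] at H
        exact Hw'.1 i j k l (by omega) (by omega) (by omega) (by omega) H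
    · rcases Nat.lt_or_ge i ρ.length with hi | hi
      · rcases Nat.lt_or_ge j ρ.length with hj | hj
        · rcases Nat.lt_or_ge (j + 1) ρ.length with hj1 | hj1
          · rcases Nat.lt_or_ge l ρ.length with h4 | h4
            · rw [hL i hi, hL j hj, hL (j + 1) hj1, hL l h4, hLL, hLL, hLL] at H
              exact Hρ'.2 i j l hij hjl h4 H
            · obtain ⟨l, rfl⟩ := hdec l h4
              obtain ⟨H1, H2, H3⟩ := H
              have H4 := lt_trans H1 H2
              have H5 := lt_trans H4 H3
              rw [hL (j + 1) hj1, hL j hj, hLL] at H5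
              rw [hL (j + 1) hj1, hR l (by omega), hLR (j + 1) _ hj1] at H4
              rw [hL j hj, hR l (by omega), hRL j _ hj] at H3
              have := HB j (j + 1) (by omega) hj1 H5
              omega
          -- The cut falls inside the adjacent pair, so the 1 would be the largest letter of all.
          · have hje : j + 1 = ρ.length + 0 := by omega
            have H1 := H.1
            rw [hje, hL i hi, hR 0 (by omega), hRL i _ hi] at H1
            have := hM _ (hrank i hi).1 (hrank i hi).2
            omega
        · obtain ⟨j, rfl⟩ := hdec j hj
          obtain ⟨l, rfl⟩ := hdec l (by omega)
          rw [add_assoc, hL i hi, hR j (by omega), hR (j + 1) (by omega), hR l (by omega), hRR,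
            hRL i _ hi, hLR i _ hi] at H
          exact (HA _ (hrank i hi).1 (hrank i hi).2).2 j l (by omega) (by omega) H
      · obtain ⟨i, rfl⟩ := hdec i hi
        obtain ⟨j, rfl⟩ := hdec j (by omega)
        obtain ⟨l, rfl⟩ := hdec l (by omega)
        rw [add_assoc, hR i (by omega), hR j (by omega), hR (j + 1) (by omega), hR l (by omega),
          hRR, hRR, hRR] at H
        exact Hw'.2 i j l (by omega) (by omega) (by omega) H

/-! Standardization. -/

theorem card_filter_le_strictMonoOn (A : Finset ℕ) :
    StrictMonoOn (fun x => (A.filter (· ≤ x)).card) {x | x ∈ A} := fun a _ b hb hab => by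
  refine Finset.card_lt_card (Finset.ssubset_iff_subset_ne.2 ⟨fun y hy => ?_, fun e => ?_⟩)
  · simp only [Finset.mem_filter] at hy ⊢
    exact ⟨hy.1, by omega⟩
  · have : b ∈ A.filter (· ≤ a) := by rw [e]; simpa using hb
    simp only [Finset.mem_filter] at this
    omega

theorem isPerm_st {w : List ℕ} (hw : w.Nodup) : IsPerm w.length (st w) := by
  apply isPerm_of_length
  · unfold st
    refine List.Nodup.map_on (fun x hx y hy e => ?_) hw
    exact (card_filter_le_strictMonoOn w.toFinset).injOn (by simpa using hx) (by simpa using hy) e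
  · simp [st]
  · intro x hx
    obtain ⟨y, hy, rfl⟩ := List.mem_map.1 hx
    refine ⟨Finset.card_pos.2 ⟨y, by simp [hy]⟩, (Finset.card_filter_le _ _).trans ?_⟩
    exact List.toFinset_card_le w

theorem st_map {w : List ℕ} {F : ℕ → ℕ} (hF : StrictMonoOn F {x | x ∈ w}) :
    st (w.map F) = st w := by
  unfold st
  rw [List.map_map]
  apply List.map_congr_left
  intro x hx
  simp only [Function.comp]
  symm
  refine Finset.card_bij (fun y _ => F y) ?_ ?_ ?_
  · intro y hy
    simp only [Finset.mem_filter, List.mem_toFinset, List.mem_map] at hy ⊢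
    exact ⟨⟨y, hy.1, rfl⟩, (hF.le_iff_le hy.1 hx).2 hy.2⟩
  · intro y hy z hz e
    simp only [Finset.mem_filter, List.mem_toFinset] at hy hz
    exact hF.injOn hy.1 hz.1 e
  · intro y hy
    simp only [Finset.mem_filter, List.mem_toFinset, List.mem_map] at hy
    obtain ⟨⟨z, hz, rfl⟩, hle⟩ := hy
    exact ⟨z, by simpa using ⟨hz, (hF.le_iff_le hz hx).1 hle⟩, rfl⟩

theorem st_of_isPerm {n : ℕ} {w : List ℕ} (hw : IsPerm n w) : st w = w := by
  unfold st
  conv_rhs => rw [← List.map_id w]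
  apply List.map_congr_left
  intro x hx
  have hxn := hw.mem_iff.1 hx
  have : w.toFinset.filter (· ≤ x) = Finset.Icc 1 x := by
    ext y
    simp only [Finset.mem_filter, List.mem_toFinset, hw.mem_iff, Finset.mem_Icc]
    omega
  simp [this]

theorem st_map_of_isPerm {n : ℕ} {w : List ℕ} (hw : IsPerm n w) {F : ℕ → ℕ} (hF : StrictMono F) :
    st (w.map F) = w := by
  rw [st_map (hF.strictMonoOn _), st_of_isPerm hw]

/-- Standardizing the two parts returns `ρ` and `w`; the level is then the front letter minus its
rank. Levels are determined only on the ranks `1, …, s`. -/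
theorem build_inj {g g' : ℕ → ℕ} (hg : Monotone g) (hg' : Monotone g') {s M s' M' : ℕ}
    {ρ w ρ' w' : List ℕ} (hρ : IsPerm s ρ) (hw : IsPerm M w) (hρ' : IsPerm s' ρ')
    (hw' : IsPerm M' w') (hs : s = s') (h : build g ρ w = build g' ρ' w') :
    ρ = ρ' ∧ w = w' ∧ ∀ r, 1 ≤ r → r ≤ s → g r = g' r := by
  subst hs
  obtain ⟨h1, h2⟩ := List.append_inj h (by simp [hρ.length, hρ'.length])
  have e1 : ρ = ρ' := by
    rw [← st_map_of_isPerm hρ (lower_strictMono hg), h1, st_map_of_isPerm hρ' (lower_strictMono hg')]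
  have e2 : w = w' := by
    rw [← st_map_of_isPerm hw (upper_strictMono _ _), h2,
      st_map_of_isPerm hw' (upper_strictMono _ _)]
  subst e1
  refine ⟨rfl, e2, fun r hr1 hr2 => ?_⟩
  have := (List.map_inj_left.1 h1) r (hρ.mem_iff.2 ⟨hr1, hr2⟩)
  unfold lower at this; omega

/-- Every permutation, cut into two parts, arises from `build`. -/
theorem exists_build {n : ℕ} {X Y : List ℕ} (h : IsPerm n (X ++ Y)) :
    ∃ g, Monotone g ∧ X = (st X).map (lower g) ∧ Y = (st Y).map (upper g X.length) := by
  have hnd := List.nodup_append.1 h.nodup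
  have hne : ∀ x ∈ X, ∀ y ∈ Y, x ≠ y := hnd.2.2
  have hmem : ∀ x, (x ∈ X ∨ x ∈ Y) ↔ 1 ≤ x ∧ x ≤ n := fun x => by
    rw [← List.mem_append, h.mem_iff]
  -- The letters of the two parts fill `{1, …, n}`, so a letter is the sum of its ranks with respect
  -- to `X` and to `Y`.
  have hsplit : ∀ m ≤ n, (X.toFinset.filter (· ≤ m)).card + (Y.toFinset.filter (· ≤ m)).card
      = m := by
    intro m hm
    rw [← Finset.card_union_of_disjoint]
    · have : X.toFinset.filter (· ≤ m) ∪ Y.toFinset.filter (· ≤ m) = Finset.Icc 1 m := by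
        ext x
        have := hmem x
        simp only [Finset.mem_union, Finset.mem_filter, List.mem_toFinset, Finset.mem_Icc]
        constructor
        · rintro (⟨h1, h2⟩ | ⟨h1, h2⟩)
          · exact ⟨(this.1 (Or.inl h1)).1, h2⟩
          · exact ⟨(this.1 (Or.inr h1)).1, h2⟩
        · rintro ⟨h1, h2⟩
          exact (this.2 ⟨h1, by omega⟩).imp (⟨·, h2⟩) (⟨·, h2⟩)
      rw [this, Nat.card_Icc]; omega
    · rw [Finset.disjoint_left]
      intro x hx hy
      simp only [Finset.mem_filter, List.mem_toFinset] at hx hy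
      exact hne x hx.1 x hy.1 rfl
  -- A rear letter is below the front letter of rank `r` when fewer than `r` front letters are below
  -- it. Phrased this way the count is defined, and monotone, for every natural number `r`.
  let g : ℕ → ℕ := fun r => (Y.toFinset.filter fun y => (X.toFinset.filter (· ≤ y)).card < r).card
  have hg : ∀ x ∈ X, g (X.toFinset.filter (· ≤ x)).card = (Y.toFinset.filter (· ≤ x)).card := by
    intro x hx
    simp only [g]
    congr 1
    apply Finset.filter_congr
    intro y hy
    have hxy := hne x hx y (by simpa using hy)
    constructor
    · intro hlt
      by_contra hc
      refine absurd hlt (not_lt.2 (Finset.card_le_card ?_))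
      exact Finset.monotone_filter_right _ fun z _ hz => by omega
    · intro hle
      apply Finset.card_lt_card
      rw [Finset.ssubset_iff_of_subset
        (Finset.monotone_filter_right _ fun z _ hz => le_trans hz hle)]
      refine ⟨x, by simp [hx], ?_⟩
      simp only [Finset.mem_filter, not_and]
      intro _
      omega
  refine ⟨g, ?_, ?_, ?_⟩
  · intro a b hab
    exact Finset.card_le_card (Finset.monotone_filter_right _ fun y _ hy => lt_of_lt_of_le hy hab)
  · unfold st
    rw [List.map_map]
    conv_lhs => rw [← List.map_id X]
    apply List.map_congr_left
    intro x hx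
    simp only [Function.comp, id, lower]
    rw [hg x hx, hsplit x ((hmem x).1 (Or.inl hx)).2]
  · unfold st
    rw [List.map_map]
    conv_lhs => rw [← List.map_id Y]
    apply List.map_congr_left
    intro y hy
    simp only [Function.comp, id, upper]
    have : ((Finset.Icc 1 X.length).filter fun r => g r < (Y.toFinset.filter (· ≤ y)).card).card =
        (X.toFinset.filter (· ≤ y)).card := by
      symm
      have hperm := isPerm_st hnd.1
      refine Finset.card_bij (fun x _ => (X.toFinset.filter (· ≤ x)).card) ?_ ?_ ?_
      · intro x hx
        simp only [Finset.mem_filter, List.mem_toFinset] at hx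
        rw [Finset.mem_filter, hg x hx.1, Finset.mem_Icc, ← hperm.mem_iff]
        refine ⟨List.mem_map.2 ⟨x, hx.1, rfl⟩, Finset.card_lt_card ?_⟩
        rw [Finset.ssubset_iff_of_subset
          (Finset.monotone_filter_right _ fun z _ hz => le_trans hz hx.2)]
        refine ⟨y, by simp [hy], ?_⟩
        have := hne x hx.1 y hy
        simp only [Finset.mem_filter, not_and]
        intro _
        omega
      · intro x hx z hz e
        simp only [Finset.mem_filter] at hx hz
        exact (card_filter_le_strictMonoOn X.toFinset).injOn hx.1 hz.1 e
      · intro r hr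
        rw [Finset.mem_filter, Finset.mem_Icc, ← hperm.mem_iff] at hr
        obtain ⟨hr1, hr2⟩ := hr
        obtain ⟨x, hx, rfl⟩ := List.mem_map.1 hr1
        rw [hg x hx] at hr2
        refine ⟨x, ?_, rfl⟩
        simp only [Finset.mem_filter, List.mem_toFinset]
        refine ⟨hx, ?_⟩
        by_contra hc
        refine absurd hr2 (not_lt.2 (Finset.card_le_card ?_))
        exact Finset.monotone_filter_right _ fun z _ hz => by omega
    rw [this, add_comm, hsplit y ((hmem y).1 (Or.inr hy)).2]

end PermWord

-- The map `ψ` moves every level to the next allowed one.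

namespace PermWord

theorem succLevel_split {M : ℕ} {w a b : List ℕ} {ℓ : ℕ} (h : IsPerm M w) (h0 : nth w 0 = M)
    (hw : Avoids w) (hℓ : Allowed w ℓ) (hM : ℓ + 1 < M) (hs : w = a ++ (ℓ + 1) :: b) :
    (∀ y ∈ a, succLevel w ℓ < y) ∧ succLevel w ℓ + 1 ∈ a := by
  have hp : a.length < w.length := by rw [hs]; simp
  have hpv : nth w a.length = ℓ + 1 := by
    rw [hs, nth_append_right _ _ le_rfl]; simp [nth]
  have hna : ∀ i < a.length, nth w i = nth a i := fun i hi => by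
    rw [hs, nth_append_left _ _ hi]
  obtain ⟨h1, v, hv, hv'⟩ := succLevel_before h h0 hw hℓ hM hp hpv
  refine ⟨fun y hy => ?_, mem_iff_nth.2 ⟨v, hv, by rw [← hna v hv, hv']⟩⟩
  obtain ⟨i, hi, rfl⟩ := mem_iff_nth.1 hy
  rw [← hna i hi]
  exact h1 i hi

theorem mCount_append_cons {u v : List ℕ} {z : ℕ} (hu : ∀ y ∈ u, z < y) (hv : ∀ y ∈ v, z < y) :
    mCount (u ++ z :: v) = v.countP fun x => ∀ y ∈ u, x < y := by
  have h1 : ∀ y ∈ u, decide (∃ x ∈ u ++ z :: v, x < y) = true := fun y hy => by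
    exact decide_eq_true ⟨z, by simp, hu y hy⟩
  have h2 : ¬ ∃ x ∈ u ++ z :: v, x < z := by
    rintro ⟨x, hx, hxz⟩
    simp only [List.mem_append, List.mem_cons] at hx
    rcases hx with hx | rfl | hx
    · exact absurd (hu x hx) (by omega)
    · omega
    · exact absurd (hv x hx) (by omega)
  have e1 : (u ++ z :: v).takeWhile (fun y => decide (∃ x ∈ u ++ z :: v, x < y)) = u := by
    rw [List.takeWhile_append_of_pos h1, List.takeWhile_cons_of_neg (by simpa using h2),
      List.append_nil]
  have e2 : (u ++ z :: v).dropWhile (fun y => decide (∃ x ∈ u ++ z :: v, x < y)) = z :: v := by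
    rw [List.dropWhile_append_of_pos h1, List.dropWhile_cons_of_neg (by simpa using h2)]
  unfold mCount
  simp only [e1, e2, List.tail_cons]

theorem sameBlock_comm {σ : List ℕ} {x z : ℕ} : SameBlock σ x z ↔ SameBlock σ z x := by
  unfold SameBlock
  rw [min_comm, max_comm]

/-- If `g r < g r'`, the rear letter of rank `g r + 1` separates the two letters; if the levels
agree, every value between them is a front letter of that same level. Thus maximal intervals are
level classes. -/
theorem sameBlock_lower {g : ℕ → ℕ} (hg : Monotone g) {s : ℕ} {ρ : List ℕ} (hρ : IsPerm s ρ)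
    {r r' : ℕ} (hr : 1 ≤ r) (hrs : r ≤ s) (hr' : 1 ≤ r') (hrs' : r' ≤ s) :
    SameBlock (ρ.map (lower g)) (lower g r) (lower g r') ↔ g r = g r' := by
  wlog hle : r ≤ r' generalizing r r'
  · rw [sameBlock_comm, this hr' hrs' hr hrs (by omega), eq_comm]
  have hmono := (lower_strictMono hg).monotone hle
  unfold SameBlock
  rw [min_eq_left hmono, max_eq_right hmono]
  constructor
  · intro H
    by_contra hne
    have hlt : g r < g r' := lt_of_le_of_ne (hg hle) hne
    have h1 := lower_lt_upper hg hrs (Nat.lt_succ_self (g r))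
    have h2 := upper_lt_lower hg (s := s) hr' (Nat.succ_le_of_lt hlt)
    obtain ⟨t, ht, hte⟩ := List.mem_map.1 (H _ (Finset.mem_Icc.2 ⟨h1.le, h2.le⟩))
    rw [hρ.mem_iff] at ht
    exact lower_ne_upper hg ht.1 ht.2 hte
  · intro he v hv
    rw [Finset.mem_Icc] at hv
    unfold lower at hv
    refine List.mem_map.2 ⟨v - g r, hρ.mem_iff.2 (by omega), ?_⟩
    have h1 := hg (show r ≤ v - g r by omega)
    have h2 := hg (show v - g r ≤ r' by omega)
    unfold lower; omega

/-- The rear letter of rank `q` lies above the level `ℓ` and not above the next level in use. -/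
def InGap (g : ℕ → ℕ) (s ℓ q : ℕ) : Prop := ℓ < q ∧ ∀ r ∈ Finset.Icc 1 s, ℓ < g r → q ≤ g r

noncomputable instance (g : ℕ → ℕ) (s ℓ q : ℕ) : Decidable (InGap g s ℓ q) :=
  Classical.dec _

theorem gapWord_build {g : ℕ → ℕ} (hg : Monotone g) {s : ℕ} {ρ : List ℕ} (hρ : IsPerm s ρ)
    (τ : List ℕ) {r : ℕ} (hr : 1 ≤ r) (hrs : r ≤ s) :
    gapWord (ρ.map (lower g)) (τ.map (upper g s)) (lower g r) =
      (τ.filter fun q => decide (InGap g s (g r) q)).map (upper g s) := by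
  unfold gapWord
  rw [List.filter_map]
  congr 1
  apply List.filter_congr
  intro q _
  simp only [Function.comp, decide_eq_decide]
  rw [List.forall_mem_map]
  constructor
  · intro H
    constructor
    · have := H r (hρ.mem_iff.2 ⟨hr, hrs⟩)
      rw [if_pos ((sameBlock_lower hg hρ hr hrs hr hrs).2 rfl)] at this
      exact (lower_lt_upper_iff hg hr hrs).1 this
    · intro r' hr' hlt
      rw [Finset.mem_Icc] at hr'
      have := H r' (hρ.mem_iff.2 hr')
      rw [if_neg fun h => hlt.ne ((sameBlock_lower hg hρ hr hrs hr'.1 hr'.2).1 h)] at this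
      refine (upper_lt_lower_iff hg hr'.1 hr'.2).1 (this (lower_strictMono hg ?_))
      by_contra hc
      have := hg (not_lt.1 hc)
      omega
  · rintro ⟨H1, H2⟩ r' hr'
    rw [hρ.mem_iff] at hr'
    split_ifs with hsb
    · rw [sameBlock_lower hg hρ hr hrs hr'.1 hr'.2] at hsb
      exact lower_lt_upper hg hr'.2 (hsb ▸ H1)
    · rw [sameBlock_lower hg hρ hr hrs hr'.1 hr'.2] at hsb
      intro hlt
      have h3 := hg ((lower_strictMono hg).lt_iff_lt.1 hlt).le
      exact upper_lt_lower hg hr'.1 (H2 r' (Finset.mem_Icc.2 hr') (by omega))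

/-- Write `ℓ = g r` and let `S` be the next allowed level. The minimum of the gap word has rank `ℓ +
1`, and all letters of `w` in front of it exceed `S`, one of them being `S + 1`. The letters counted
are therefore those of ranks `ℓ + 2, …, S`. All of them do lie in the gap, since any higher level in
use is allowed and hence at least `S`. There are `S - ℓ - 1` of them. -/
theorem mCount_gapWord {g : ℕ → ℕ} (hg : Monotone g) {s M : ℕ} {ρ τ : List ℕ} (hρ : IsPerm s ρ)
    (hw : IsPerm M (M :: τ)) (hwA : Avoids (M :: τ)) (hM : ∀ r, 1 ≤ r → r ≤ s → g r + 1 < M)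
    (hA : ∀ r, 1 ≤ r → r ≤ s → Allowed (M :: τ) (g r)) {r : ℕ} (hr : 1 ≤ r) (hrs : r ≤ s) :
    g r + mCount (gapWord (ρ.map (lower g)) (τ.map (upper g s)) (lower g r)) + 1 =
      succLevel (M :: τ) (g r) := by
  have h0 : nth (M :: τ) 0 = M := by simp [nth]
  have hℓM := hM r hr hrs
  have hnd := hw.nodup
  have hmemτ : ∀ q, q ∈ τ ↔ 1 ≤ q ∧ q < M := by
    intro q
    have h1 := hw.mem_iff (x := q)
    have h2 := (List.nodup_cons.1 hnd).1
    rw [List.mem_cons] at h1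
    constructor
    · intro hq
      have := h1.1 (Or.inr hq)
      have : q ≠ M := fun e => h2 (e ▸ hq)
      omega
    · intro hq
      rcases h1.2 ⟨hq.1, hq.2.le⟩ with h | h
      · omega
      · exact h
  obtain ⟨a, b, rfl⟩ := List.append_of_mem ((hmemτ (g r + 1)).2 ⟨by omega, hℓM⟩)
  have hS := succLevel_spec hw h0 (g r)
  have hSM := succLevel_lt hw h0 hℓM
  obtain ⟨hS1, hS2⟩ := succLevel_split hw h0 hwA (hA r hr hrs) hℓM
    (show M :: (a ++ (g r + 1) :: b) = (M :: a) ++ (g r + 1) :: b from rfl)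
  generalize hSdef : succLevel (M :: (a ++ (g r + 1) :: b)) (g r) = S at *
  -- The rank `g r + 1` lies in every such gap, which makes it the minimum `0̂` of the gap word.
  have hP0 : InGap g s (g r) (g r + 1) :=
    ⟨by omega, fun r' _ h => h⟩
  rw [List.nodup_cons, List.nodup_append] at hnd
  obtain ⟨-, hnda, hndb, hab⟩ := hnd
  rw [List.nodup_cons] at hndb
  rw [gapWord_build hg hρ _ hr hrs, List.filter_append, List.filter_cons_of_pos (by simpa using hP0),
    List.map_append, List.map_cons]
  have hmono := upper_strictMono g s
  have hlow : ∀ c : List ℕ, (∀ q ∈ c, q ≠ g r + 1) → ∀ y ∈ (c.filter fun q =>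
      decide (InGap g s (g r) q)).map (upper g s),
      upper g s (g r + 1) < y := by
    intro c hc y hy
    obtain ⟨q, hq, rfl⟩ := List.mem_map.1 hy
    rw [List.mem_filter, decide_eq_true_eq] at hq
    have := hc q hq.1
    have := hq.2.1
    exact hmono (by omega)
  rw [mCount_append_cons (hlow a fun q hq => hab q hq _ (by simp))
    (hlow b fun q hq e => hndb.1 (e ▸ hq)), List.countP_map, List.countP_filter]
  have hcount : ∀ q ∈ b, ((((fun x => decide (∀ y ∈ (a.filter fun q =>
      decide (InGap g s (g r) q)).map (upper g s), x < y)) ∘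
      upper g s) q && decide (InGap g s (g r) q)) = true ↔
      decide (g r + 1 < q ∧ q ≤ S) = true) := by
    intro q hq
    rw [Bool.and_eq_true, decide_eq_true_eq, decide_eq_true_eq, Function.comp, decide_eq_true_eq,
      List.forall_mem_map]
    constructor
    · rintro ⟨H1, H2, H3⟩
      have hne : q ≠ g r + 1 := fun e => hndb.1 (e ▸ hq)
      refine ⟨by omega, ?_⟩
      by_contra hc
      have hqM := (hmemτ q).1 (by simp [hq])
      rcases List.mem_cons.1 hS2 with h | h
      · omega
      -- A gap letter `q > S` brings `S + 1` into the gap as well. As `S + 1` stands in front of the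
      -- minimum, `q` is not smaller than all letters there.
      · have := hmono.lt_iff_lt.1 (H1 (S + 1) (List.mem_filter.2 ⟨h, decide_eq_true
          ⟨by omega, fun r' hr' hlt => by have := H3 r' hr' hlt; omega⟩⟩))
        omega
    · rintro ⟨H1, H2⟩
      refine ⟨fun y hy => hmono ?_, by omega, fun r' hr' hlt => ?_⟩
      · have := hS1 y (List.mem_cons_of_mem _ (List.mem_filter.1 hy).1)
        omega
      · rw [Finset.mem_Icc] at hr'
        have := succLevel_le hlt (hA r' hr'.1 hr'.2)
        omega
  rw [List.countP_congr hcount, List.countP_eq_length_filter]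
  have hcard : (b.filter fun q => decide (g r + 1 < q ∧ q ≤ S)).length =
      (Finset.Ioc (g r + 1) S).card := by
    rw [← List.toFinset_card_of_nodup (hndb.2.filter _)]
    congr 1
    ext q
    simp only [List.mem_toFinset, List.mem_filter, decide_eq_true_eq, Finset.mem_Ioc,
      and_iff_right_iff_imp]
    intro hq
    have := (hmemτ q).2 ⟨by omega, by omega⟩
    rw [List.mem_append, List.mem_cons] at this
    rcases this with h | h | h
    · have := hS1 q (List.mem_cons_of_mem _ h)
      omega
    · omega
    · exact h
  rw [hcard, Nat.card_Ioc]
  omega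

theorem stInv_image {F : ℕ → ℕ} (hF : StrictMono F) {m : ℕ} {w : List ℕ} (hw : IsPerm m w) :
    stInv ((Finset.Icc 1 m).image F) w = w.map F := by
  have hsort : ((Finset.Icc 1 m).image F).sort (· ≤ ·) = (List.range' 1 m).map F := by
    refine List.Perm.eq_of_pairwise' (r := (· ≤ ·)) (Finset.pairwise_sort _ _) ?_ ?_
    · rw [List.pairwise_map]
      exact (List.pairwise_lt_range' (s := 1) (n := m)).imp fun h => (hF h).le
    · rw [List.perm_ext_iff_of_nodup (Finset.sort_nodup _ _)
        ((List.nodup_range' ..).map hF.injective)]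
      intro x
      simp only [Finset.mem_sort, Finset.mem_image, List.mem_map, Finset.mem_Icc,
        List.mem_range'_1]
      exact exists_congr fun y => and_congr_left fun _ => by omega
  unfold stInv
  rw [hsort]
  apply List.map_congr_left
  intro r hr
  rw [hw.mem_iff] at hr
  have : r - 1 < ((List.range' 1 m).map F).length := by simp; omega
  rw [List.getD_eq_getElem _ _ this]
  simp only [List.getElem_map, List.getElem_range']
  congr 1; omega

/-- By `mCount_gapWord` the set `L` consists of the front letters for the raised levels; its
complement then consists of the rear letters for those levels, and refilling both sets keeps the
patterns. The bound `g r + 1 < M` expresses that the largest letter precedes the second largest, and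
it keeps the raised levels below `M`. -/
theorem psi_build {g : ℕ → ℕ} (hg : Monotone g) {s M : ℕ} {ρ w : List ℕ} (hρ : IsPerm s ρ)
    (hw : IsPerm M w) (h0 : nth w 0 = M) (hM0 : 0 < M) (hwA : Avoids w)
    (hM : ∀ r, 1 ≤ r → r ≤ s → g r + 1 < M)
    (hA : ∀ r, 1 ≤ r → r ≤ s → Allowed w (g r)) :
    psi (build g ρ w) = build (succLevel w ∘ g) ρ w := by
  obtain ⟨m, τ, rfl⟩ : ∃ m τ, w = m :: τ := by
    cases w with
    | nil => have := hw.length; simp at this; omega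
    | cons m τ => exact ⟨m, τ, rfl⟩
  obtain rfl : m = M := by simpa [nth] using h0
  have hl := hρ.length
  have hg2 : Monotone (succLevel (m :: τ) ∘ g) := (succLevel_mono hw h0).comp hg
  have hM2 : ∀ r, 1 ≤ r → r ≤ s → (succLevel (m :: τ) ∘ g) r < m := fun r h1 h2 =>
    succLevel_lt hw h0 (hM r h1 h2)
  have hmc : ∀ {r}, 1 ≤ r → r ≤ s → _ := fun {r} => mCount_gapWord hg hρ hw hwA hM hA (r := r)
  have hU : upper g s m = s + m := by
    rw [upper_eq fun r h1 h2 => by have := hM r h1 h2; omega, add_comm]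
  have hU2 : upper (succLevel (m :: τ) ∘ g) s m = s + m := by
    rw [upper_eq hM2, add_comm]
  have hn : (build g ρ (m :: τ)).length = s + m := by rw [length_build, hl, hw.length]
  have hperm2 := isPerm_build hg2 hρ hw fun r h1 h2 => (hM2 r h1 h2).le
  have hτ : IsPerm (m - 1) τ := by
    have hnd := List.nodup_cons.1 hw.nodup
    have hlen := hw.length
    rw [List.length_cons] at hlen
    refine isPerm_of_length hnd.2 (by omega) fun x hx => ?_
    have := hw.mem_iff.1 (List.mem_cons_of_mem _ hx)
    have : x ≠ m := fun e => hnd.1 (e ▸ hx)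
    omega
  have hlow : ∀ x ∈ ρ.map (lower g), decide (x ≠ s + m) = true := by
    intro x hx
    obtain ⟨r, hr, rfl⟩ := List.mem_map.1 hx
    rw [hρ.mem_iff] at hr
    have := hM r hr.1 hr.2
    rw [decide_eq_true_eq]
    unfold lower; omega
  have hb : build g ρ (m :: τ) = ρ.map (lower g) ++ (s + m) :: τ.map (upper g s) := by
    simp [build, hl, hU]
  have e1 : (build g ρ (m :: τ)).takeWhile (fun x => decide (x ≠ s + m)) = ρ.map (lower g) := by
    rw [hb, List.takeWhile_append_of_pos hlow, List.takeWhile_cons_of_neg (by simp),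
      List.append_nil]
  have e2 : ((build g ρ (m :: τ)).dropWhile (fun x => decide (x ≠ s + m))).tail =
      τ.map (upper g s) := by
    rw [hb, List.dropWhile_append_of_pos hlow, List.dropWhile_cons_of_neg (by simp),
      List.tail_cons]
  have eL : ((ρ.map (lower g)).toFinset.image fun x =>
      x + mCount (gapWord (ρ.map (lower g)) (τ.map (upper g s)) x) + 1) =
      (Finset.Icc 1 s).image (lower (succLevel (m :: τ) ∘ g)) := by
    have hset : (ρ.map (lower g)).toFinset = (Finset.Icc 1 s).image (lower g) := by
      ext x
      simp only [List.mem_toFinset, List.mem_map, hρ.mem_iff, Finset.mem_image, Finset.mem_Icc]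
    rw [hset, Finset.image_image]
    apply Finset.image_congr
    intro r hr
    rw [Finset.mem_coe, Finset.mem_Icc] at hr
    have := hmc hr.1 hr.2
    simp only [Function.comp_apply, lower] at this ⊢
    omega
  have eR : Finset.Icc 1 (s + m - 1) \ (Finset.Icc 1 s).image (lower (succLevel (m :: τ) ∘ g)) =
      (Finset.Icc 1 (m - 1)).image (upper (succLevel (m :: τ) ∘ g) s) := by
    ext x
    simp only [Finset.mem_sdiff, Finset.mem_Icc, Finset.mem_image, not_exists, not_and]
    constructor
    · rintro ⟨hx, hxl⟩
      have := hperm2.mem_iff.2 (⟨hx.1, by omega⟩ : 1 ≤ x ∧ x ≤ s + m)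
      rcases List.mem_append.1 this with h | h
      · obtain ⟨r, hr, rfl⟩ := List.mem_map.1 h
        exact absurd rfl (hxl r (hρ.mem_iff.1 hr))
      · obtain ⟨q, hq, rfl⟩ := List.mem_map.1 h
        rw [hl] at hx ⊢
        refine ⟨q, ?_, rfl⟩
        have hq' := hw.mem_iff.1 hq
        have : q ≠ m := fun e => by subst e; omega
        omega
    · rintro ⟨q, hq, rfl⟩
      have h1 := upper_strictMono (succLevel (m :: τ) ∘ g) s (show q < m by omega)
      have h2 := le_upper (succLevel (m :: τ) ∘ g) s q
      exact ⟨by omega, fun r hr => lower_ne_upper hg2 hr.1 hr.2⟩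
  unfold psi
  simp only [hn, e1, e2, eL, eR]
  rw [st_map_of_isPerm hρ (lower_strictMono hg), st_map_of_isPerm hτ (upper_strictMono g s),
    stInv_image (lower_strictMono hg2) hρ, stInv_image (upper_strictMono _ _) hτ]
  simp [build, hl, hU2]

end PermWord

-- Indecomposability in terms of levels, and cutting in front of the largest letter.

namespace PermWord

/-- No proper nonempty prefix of length `j` consists of letters at most `j`; for a permutation
this means that it is not the direct sum of two nonempty permutations. -/
def Indec (w : List ℕ) : Prop := ∀ j, 0 < j → j < w.length → ∃ x ∈ w.take j, j < x

theorem isPerm_take {n j : ℕ} {w : List ℕ} (hw : IsPerm n w) (hj : j ≤ w.length)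
    (h : ∀ x ∈ w.take j, x ≤ j) : IsPerm j (w.take j) :=
  isPerm_of_length (hw.nodup.sublist (List.take_sublist _ _)) (by simpa using hj) fun x hx =>
    ⟨(hw.mem_iff.1 (List.mem_of_mem_take hx)).1, h x hx⟩

theorem indec_cons_max {n : ℕ} {w : List ℕ} (h : w.length ≤ n) : Indec ((n + 1) :: w) := by
  intro j hj hjl
  obtain ⟨j, rfl⟩ : ∃ k, j = k + 1 := ⟨j - 1, by omega⟩
  exact ⟨n + 1, by simp, by simp at hjl; omega⟩

theorem build_max {g : ℕ → ℕ} {s M : ℕ} {ρ w : List ℕ} (hρ : IsPerm s ρ) (hw : IsPerm M w)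
    (h0 : nth w 0 = M) (hM0 : 0 < M) (hM : ∀ r, 1 ≤ r → r ≤ s → g r < M) :
    build g ρ w = ρ.map (lower g) ++ (s + M) :: (w.tail.map (upper g s)) := by
  have hl := hw.length
  cases w with
  | nil => simp at hl; omega
  | cons m w =>
    obtain rfl : m = M := by simpa [nth] using h0
    simp only [build, hρ.length, List.map_cons, List.tail_cons, upper_eq hM, add_comm s m]

/-- A proper prefix reaching into the rear part contains the largest letter. A prefix of the front
part with letters at most its length would contain `1`, but positive levels make all front letters
at least `2`. -/
theorem indec_build {g : ℕ → ℕ} {s M : ℕ} {ρ w : List ℕ} (hg : Monotone g) (hρ : IsPerm s ρ)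
    (hw : IsPerm M w) (h0 : nth w 0 = M) (hM0 : 0 < M) (hM : ∀ r, 1 ≤ r → r ≤ s → g r < M)
    (hpos : ∀ r, 1 ≤ r → r ≤ s → 0 < g r) : Indec (build g ρ w) := by
  intro j hj hjl
  have hperm := isPerm_build hg hρ hw fun r h1 h2 => (hM r h1 h2).le
  have hl := hρ.length
  have hwl := hw.length
  rcases Nat.lt_or_ge s j with hsj | hsj
  · refine ⟨s + M, ?_, by rw [length_build] at hjl; omega⟩
    rw [build_max hρ hw h0 hM0 hM, List.take_append, List.length_map, hl]
    obtain ⟨k, hk⟩ : ∃ k, j - s = k + 1 := ⟨j - s - 1, by omega⟩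
    simp [hk]
  · by_contra hc
    push Not at hc
    have h1 := (isPerm_take hperm hjl.le hc).mem_iff.2 (⟨le_rfl, hj⟩ : 1 ≤ 1 ∧ 1 ≤ j)
    rw [build, List.take_append_of_le_length (by simp; omega)] at h1
    obtain ⟨r, hr, hr1⟩ := List.mem_map.1 (List.mem_of_mem_take h1)
    rw [hρ.mem_iff] at hr
    have := hpos r hr.1 hr.2
    unfold lower at hr1; omega

/-- The front letters of level `0` are the smallest letters of the permutation, and by `Blocked`
they come first; if there were any, they would split off as a direct summand. -/
theorem pos_of_indec_build {g : ℕ → ℕ} {s M : ℕ} {ρ w : List ℕ} (hg : Monotone g)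
    (hρ : IsPerm s ρ) (hw : IsPerm M w) (hM0 : 0 < M) (hB : Blocked g ρ)
    (hI : Indec (build g ρ w)) : ∀ r, 1 ≤ r → r ≤ s → 0 < g r := by
  intro r0 hr0 hrs
  by_contra hc
  have hl := hρ.length
  set Z := (Finset.Icc 1 s).filter fun r => g r = 0 with hZ
  have hZpos : 0 < Z.card := Finset.card_pos.2 ⟨r0, by simp [hZ]; omega⟩
  have hZs : Z.card ≤ s := by
    have := Finset.card_filter_le (Finset.Icc 1 s) fun r => g r = 0
    rwa [Nat.card_Icc, Nat.add_sub_cancel] at this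
  obtain ⟨x, hx, hlt⟩ := hI Z.card hZpos (by rw [length_build, hl, hw.length]; omega)
  rw [build, List.take_append_of_le_length (by simp; omega)] at hx
  obtain ⟨i, hi, rfl⟩ := mem_iff_nth.1 hx
  rw [List.length_take, List.length_map] at hi
  have hnth : nth ((ρ.map (lower g)).take Z.card) i = lower g (nth ρ i) := by
    rw [← nth_map (lower g) ρ (by omega)]
    simp [nth, show i < Z.card by omega]
  rw [hnth] at hlt
  have hρi := hρ.mem_iff.1 (nth_mem (show i < ρ.length by omega))
  have hgi : g (nth ρ i) = 0 := by
    -- A letter of positive level at position `i` has all letters of level `0` in front of it, so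
    -- there would be at most `i` of those, while `i < Z.card`.
    by_contra hgi
    have hsub : Z ⊆ (ρ.take i).toFinset := by
      intro r hr
      rw [hZ, Finset.mem_filter, Finset.mem_Icc] at hr
      obtain ⟨k, hk, rfl⟩ := mem_iff_nth.1 (hρ.mem_iff.2 hr.1)
      have hki : k < i := by
        by_contra hki
        have hne : i ≠ k := fun e => by subst e; omega
        have hlt' : nth ρ k < nth ρ i := by
          by_contra hge
          have := hg (not_lt.1 hge)
          omega
        have := hB i k (by omega) hk hlt'
        omega
      rw [List.mem_toFinset]
      refine mem_iff_nth.2 ⟨k, by simp; omega, by simp [nth, hki]⟩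
    have h1 := Finset.card_le_card hsub
    have h2 := List.toFinset_card_le (ρ.take i)
    rw [List.length_take] at h2
    omega
  have hsub : Finset.Icc 1 (nth ρ i) ⊆ Z := by
    intro r hr
    rw [Finset.mem_Icc] at hr
    rw [hZ, Finset.mem_filter, Finset.mem_Icc]
    have := hg hr.2
    omega
  have := Finset.card_le_card hsub
  rw [Nat.card_Icc] at this
  unfold lower at hlt
  omega

theorem upper_congr {g g' : ℕ → ℕ} {s : ℕ} (h : ∀ r, 1 ≤ r → r ≤ s → g r = g' r) (q : ℕ) :
    upper g s q = upper g' s q := by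
  unfold upper
  congr 2
  apply Finset.filter_congr
  intro r hr
  rw [Finset.mem_Icc] at hr
  rw [h r hr.1 hr.2]

theorem build_congr {g g' : ℕ → ℕ} {s : ℕ} {ρ : List ℕ} (w : List ℕ) (hρ : IsPerm s ρ)
    (h : ∀ r, 1 ≤ r → r ≤ s → g r = g' r) : build g ρ w = build g' ρ w := by
  unfold build
  rw [hρ.length]
  congr 1
  · apply List.map_congr_left
    intro r hr
    rw [hρ.mem_iff] at hr
    unfold lower
    rw [h r hr.1 hr.2]
  · apply List.map_congr_left
    intro q _
    exact upper_congr h q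

/-- A permutation, cut in front of its largest letter, arises from `build`. -/
theorem exists_build_max {n : ℕ} {X Y : List ℕ} (h : IsPerm n (X ++ n :: Y)) :
    ∃ g ρ w, Monotone g ∧ IsPerm X.length ρ ∧ IsPerm (Y.length + 1) w ∧
      nth w 0 = Y.length + 1 ∧ (∀ r, 1 ≤ r → r ≤ X.length → g r < Y.length + 1) ∧
      X = ρ.map (lower g) ∧ n :: Y = w.map (upper g X.length) := by
  obtain ⟨g, hg, hX, hY⟩ := exists_build h
  have hnd := List.nodup_append.1 h.nodup
  have hρ := isPerm_st hnd.1
  have hw := isPerm_st hnd.2.1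
  have hn : n = X.length + (Y.length + 1) := by
    rw [← h.length]; simp
  rw [List.length_cons] at hw
  have hw0 : nth (st (n :: Y)) 0 = Y.length + 1 := by
    have h1 : nth (n :: Y) 0 = n := by simp [nth]
    rw [hY, nth_map _ _ (by rw [hw.length]; omega)] at h1
    have h2 := upper_le g X.length (nth (st (n :: Y)) 0)
    have h3 := nth_le hw 0
    omega
  refine ⟨g, st X, st (n :: Y), hg, hρ, hw, hw0, ?_, hX, hY⟩
  intro r hr1 hr2
  have hx : lower g r ∈ X := by
    rw [hX]; exact List.mem_map.2 ⟨r, hρ.mem_iff.2 ⟨hr1, hr2⟩, rfl⟩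
  have hxn : lower g r < n := by
    have := (h.mem_iff.1 (List.mem_append_left _ hx)).2
    have := hnd.2.2 _ hx n (by simp)
    omega
  have h1 : nth (n :: Y) 0 = n := by simp [nth]
  rw [hY, nth_map _ _ (by rw [hw.length]; omega), hw0] at h1
  rw [← h1] at hxn
  exact (lower_lt_upper_iff hg hr1 hr2).1 hxn

/-! Insertion of a new largest letter in front of a left-to-right maximum. -/

theorem nth_insert (X Z : List ℕ) (N i : ℕ) : nth (X ++ N :: Z) i =
    if i < X.length then nth (X ++ Z) i else if i = X.length then N else nth (X ++ Z) (i - 1) := by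
  split_ifs with h1 h2
  · rw [nth_append_left _ _ h1, nth_append_left _ _ h1]
  · rw [nth_append_right _ _ (by omega), h2]; simp [nth]
  · rw [nth_append_right _ _ (by omega), nth_append_right _ _ (by omega)]
    obtain ⟨k, hk⟩ : ∃ k, i - X.length = k + 1 := ⟨i - X.length - 1, by omega⟩
    rw [hk, show i - 1 - X.length = k by omega]
    simp [nth]

/-- A new occurrence can use `N` only as its 4. In a 3-1-4-2 the letter `y` can take over that role,
since it exceeds everything in `X`; in a 2-41-3 the 1 would be `y`, which exceeds every possible 2.
Conversely, the insertion separates only the last letter of `X` from `y`, and `y` cannot be the 1 of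
a 2-41-3. -/
theorem avoids_insert {X Y : List ℕ} {N y : ℕ} (hX : ∀ x ∈ X, x < y)
    (hN : ∀ x ∈ X ++ y :: Y, x < N) : Avoids (X ++ N :: y :: Y) ↔ Avoids (X ++ y :: Y) := by
  have hy : nth (X ++ y :: Y) X.length = y := by
    rw [nth_append_right _ _ le_rfl]; simp [nth]
  have hlt : ∀ i < X.length, nth (X ++ y :: Y) i < y := fun i hi => by
    rw [nth_append_left _ _ hi]; exact hX _ (nth_mem hi)
  have hltN : ∀ i < (X ++ y :: Y).length, nth (X ++ y :: Y) i < N := fun i hi => hN _ (nth_mem hi)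
  have hins : ∀ i, nth (X ++ N :: y :: Y) (if i < X.length then i else i + 1) =
      nth (X ++ y :: Y) i := by
    intro i
    rw [nth_insert]
    split_ifs <;> first | rfl | omega
  have hlen1 : (X ++ N :: y :: Y).length = X.length + Y.length + 2 := by simp; omega
  have hlen2 : (X ++ y :: Y).length = X.length + Y.length + 1 := by simp; omega
  rw [avoids_iff, avoids_iff, hlen1, hlen2]
  rw [hlen2] at hltN
  constructor
  · rintro ⟨h1, h2⟩
    refine ⟨fun i j k l hij hjk hkl hl H => ?_, fun i j l hij hjl hl H => ?_⟩
    · rw [← hins i, ← hins j, ← hins k, ← hins l] at H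
      refine h1 _ _ _ _ ?_ ?_ ?_ ?_ H <;> split_ifs <;> omega
    · by_cases hj : j + 1 = X.length
      · have := hlt i (by omega)
        rw [hj, hy] at H
        omega
      · have e : (if j + 1 < X.length then j + 1 else j + 1 + 1) =
            (if j < X.length then j else j + 1) + 1 := by split_ifs <;> omega
        rw [← hins i, ← hins j, ← hins (j + 1), ← hins l, e] at H
        refine h2 _ _ _ ?_ ?_ ?_ H <;> split_ifs <;> omega
  · rintro ⟨h1, h2⟩
    have hdel : ∀ i, i ≠ X.length → nth (X ++ N :: y :: Y) i =
        nth (X ++ y :: Y) (if i < X.length then i else i - 1) := by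
      intro i hi
      rw [nth_insert]
      split_ifs <;> rfl
    have hdelL : ∀ i, i < X.length → nth (X ++ N :: y :: Y) i = nth (X ++ y :: Y) i :=
      fun i hi => by rw [nth_insert, if_pos hi]
    have hdelR : ∀ i, X.length < i → nth (X ++ N :: y :: Y) i = nth (X ++ y :: Y) (i - 1) :=
      fun i hi => by rw [nth_insert, if_neg (by omega), if_neg (by omega)]
    have hs : nth (X ++ N :: y :: Y) X.length = N := by
      rw [nth_insert]; simp
    have hleN : ∀ i < X.length + Y.length + 2, nth (X ++ N :: y :: Y) i ≤ N := by
      intro i hi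
      by_cases h : i = X.length
      · rw [h, hs]
      · rw [hdel i h]
        apply le_of_lt
        apply hltN
        split_ifs <;> omega
    refine ⟨fun i j k l hij hjk hkl hl H => ?_, fun i j l hij hjl hl H => ?_⟩
    · have bi := hleN i (by omega)
      have bk := hleN k (by omega)
      have bl := hleN l (by omega)
      have hi : i ≠ X.length := fun e => by rw [e, hs] at H; omega
      have hj : j ≠ X.length := fun e => by rw [e, hs] at H; omega
      have hl' : l ≠ X.length := fun e => by rw [e, hs] at H; omega
      by_cases hk : k = X.length
      · rw [hdelL i (by omega), hdelL j (by omega), hdelR l (by omega)] at H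
        have hiy := hlt i (by omega)
        by_cases hl1 : l = X.length + 1
        · rw [hl1, Nat.add_sub_cancel, hy] at H
          omega
        · refine h1 i j X.length (l - 1) hij (by omega) (by omega) (by omega) ⟨H.1, H.2.1, ?_⟩
          rw [hy]; exact hiy
      · rw [hdel i hi, hdel j hj, hdel k hk, hdel l hl'] at H
        refine h1 _ _ _ _ ?_ ?_ ?_ ?_ H <;> split_ifs <;> omega
    · have bj := hleN j (by omega)
      have bl := hleN l (by omega)
      have hi : i ≠ X.length := fun e => by rw [e, hs] at H; omega
      have hl' : l ≠ X.length := fun e => by rw [e, hs] at H; omega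
      have hj1 : j + 1 ≠ X.length := fun e => by rw [e, hs] at H; omega
      by_cases hj : j = X.length
      · rw [hdelL i (by omega), hdelR (j + 1) (by omega), Nat.add_sub_cancel, hj, hy] at H
        have := hlt i (by omega)
        omega
      · have e : (if j + 1 < X.length then j + 1 else j + 1 - 1) =
            (if j < X.length then j else j - 1) + 1 := by split_ifs <;> omega
        rw [hdel i hi, hdel j hj, hdel (j + 1) hj1, hdel l hl', e] at H
        refine h2 _ _ _ ?_ ?_ ?_ H <;> split_ifs <;> omega

/-- The number of left-to-right maxima of a word that exceed `m`. -/
def lmaxAbove : ℕ → List ℕ → ℕ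
  | _, [] => 0
  | m, a :: l => if m < a then 1 + lmaxAbove a l else lmaxAbove m l

theorem lmaxAbove_concat (m a : ℕ) (l : List ℕ) : lmaxAbove m (l ++ [a]) =
    (if m < a ∧ ∀ x ∈ l, x < a then 1 else 0) + lmaxAbove m l := by
  induction l generalizing m with
  | nil => simp [lmaxAbove]
  | cons b l ih =>
    rw [List.cons_append, lmaxAbove, lmaxAbove, ih, ih]
    split_ifs <;> simp_all <;> omega

theorem lmax_eq_lmaxAbove {l : List ℕ} (h : l.Nodup) (hpos : ∀ x ∈ l, 0 < x) :
    lmax l = lmaxAbove 0 l := by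
  induction l using List.reverseRecOn with
  | nil => simp [lmax_eq_rmax_reverse, rmax_nil, lmaxAbove]
  | append_singleton l a ih =>
    have hnd := List.nodup_append.1 h
    rw [lmaxAbove_concat, ← ih hnd.1 fun x hx => hpos x (by simp [hx]), lmax_eq_rmax_reverse,
      lmax_eq_rmax_reverse, List.reverse_append, List.reverse_singleton, List.singleton_append,
      rmax_cons]
    congr 1
    refine if_congr ?_ rfl rfl
    simp only [List.mem_reverse, hpos a (by simp), true_and]
    refine forall₂_congr fun x hx => ?_
    have := hnd.2.2 x hx a (by simp)
    omega

theorem insertAux_spec (N : ℕ) : ∀ (l : List ℕ) (m i : ℕ), 1 ≤ i → i ≤ lmaxAbove m l →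
    ∃ X y Y, l = X ++ y :: Y ∧ insertAux N m i l = X ++ N :: y :: Y ∧ (∀ x ∈ X, x < y) ∧ m < y ∧
      lmaxAbove m X + 1 = i
  | [], m, i, h1, h2 => by simp [lmaxAbove] at h2; omega
  | a :: l, m, i, h1, h2 => by
    rw [lmaxAbove] at h2
    by_cases hma : m < a
    · rw [if_pos hma] at h2
      by_cases hi : i ≤ 1
      · exact ⟨[], a, l, rfl, by simp [insertAux, hma, hi], by simp, hma, by
          simp [lmaxAbove]; omega⟩
      · obtain ⟨X, y, Y, e1, e2, h3, h4, h5⟩ := insertAux_spec N l a (i - 1) (by omega) (by omega)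
        refine ⟨a :: X, y, Y, by simp [e1], by simp [insertAux, hma, hi, e2], ?_, by omega, ?_⟩
        · simpa using ⟨h4, h3⟩
        · rw [lmaxAbove, if_pos hma]; omega
    · rw [if_neg hma] at h2
      obtain ⟨X, y, Y, e1, e2, h3, h4, h5⟩ := insertAux_spec N l m i h1 h2
      refine ⟨a :: X, y, Y, by simp [e1], by simp [insertAux, hma, e2], ?_, h4, ?_⟩
      · simpa using ⟨by omega, h3⟩
      · rw [lmaxAbove, if_neg hma, h5]

theorem insertAux_eq (N y : ℕ) (Y : List ℕ) : ∀ (X : List ℕ) (m : ℕ), (∀ x ∈ X, x < y) → m < y →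
    insertAux N m (lmaxAbove m X + 1) (X ++ y :: Y) = X ++ N :: y :: Y
  | [], m, _, hm => by simp [lmaxAbove, insertAux, hm]
  | a :: X, m, hX, hm => by
    rw [lmaxAbove, List.cons_append, insertAux]
    have ha := hX a (by simp)
    have hX' : ∀ x ∈ X, x < y := fun x hx => hX x (by simp [hx])
    split_ifs with h1 h2
    · omega
    · rw [show 1 + lmaxAbove a X + 1 - 1 = lmaxAbove a X + 1 by omega,
        insertAux_eq N y Y X a hX' ha, List.cons_append]
    · rw [insertAux_eq N y Y X m hX' hm, List.cons_append]

theorem hat_one {n : ℕ} {π : List ℕ} (hπ : IsPerm n π) : hat 1 π = (n + 1) :: π := by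
  unfold hat
  rw [hπ.length]
  cases π with
  | nil => simp [insertAux]
  | cons a l =>
    have := (hπ.mem_iff.1 (List.mem_cons_self (a := a) (l := l))).1
    simp [insertAux, show 0 < a by omega]

theorem hat_spec {n i : ℕ} {π : List ℕ} (hπ : IsPerm n π) (h1 : 1 < i) (hi : i ≤ lmax π) :
    ∃ X y Y, X ≠ [] ∧ π = X ++ y :: Y ∧ hat i π = X ++ (n + 1) :: y :: Y ∧ (∀ x ∈ X, x < y) ∧
      lmax X + 1 = i := by
  rw [lmax_eq_lmaxAbove hπ.nodup fun x hx => (hπ.mem_iff.1 hx).1] at hi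
  obtain ⟨X, y, Y, e1, e2, h3, h4, h5⟩ := insertAux_spec (n + 1) π 0 i (by omega) hi
  have hX : lmax X = lmaxAbove 0 X := by
    apply lmax_eq_lmaxAbove
    · exact hπ.nodup.sublist (by rw [e1]; exact List.sublist_append_left _ _)
    · intro x hx
      exact (hπ.mem_iff.1 (by rw [e1]; simp [hx])).1
  refine ⟨X, y, Y, ?_, e1, by rw [hat, hπ.length, e2], h3, by rw [hX, h5]⟩
  rintro rfl
  simp [lmaxAbove] at h5
  omega

theorem hat_eq {n y : ℕ} {X Y : List ℕ} (hπ : IsPerm n (X ++ y :: Y)) (hX : ∀ x ∈ X, x < y) :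
    hat (lmax X + 1) (X ++ y :: Y) = X ++ (n + 1) :: y :: Y := by
  have hX' : lmax X = lmaxAbove 0 X := by
    apply lmax_eq_lmaxAbove
    · exact hπ.nodup.sublist (List.sublist_append_left _ _)
    · intro x hx
      exact (hπ.mem_iff.1 (by simp [hx])).1
  rw [hX', hat, hπ.length]
  exact insertAux_eq _ _ _ _ _ hX (hπ.mem_iff.1 (by simp)).1

theorem isPerm_insert {n : ℕ} {X Y : List ℕ} :
    IsPerm (n + 1) (X ++ (n + 1) :: Y) ↔ IsPerm n (X ++ Y) := by
  unfold IsPerm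
  rw [List.range'_1_concat, add_comm 1 n]
  constructor
  · intro h
    exact (List.perm_cons (n + 1)).1 (List.perm_middle.symm.trans
      (h.trans (List.perm_append_singleton _ _)))
  · intro h
    exact (List.perm_middle.trans (h.cons (n + 1))).trans (List.perm_append_singleton _ _).symm

end PermWord

-- The maps `φ_i` as a bijection onto indecomposable avoiders.

namespace PermWord

theorem blocked_comp {g : ℕ → ℕ} {ρ : List ℕ} (h : Blocked g ρ) (F : ℕ → ℕ) :
    Blocked (F ∘ g) ρ := fun i j hij hj hlt => congrArg F (h i j hij hj hlt)

/-- Since `y` exceeds the letters of `X`, every level is below the rank of `y` in the rear pattern,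
which is itself below the maximal rank. This is the strict bound that `psi_build` requires. -/
theorem psi_insert {n y : ℕ} {X Y : List ℕ} (h : X ++ (n + 1) :: y :: Y ∈ avoiders (n + 1))
    (hX : ∀ x ∈ X, x < y) : ∃ g ρ w, Monotone g ∧ IsPerm X.length ρ ∧
      IsPerm (Y.length + 2) w ∧ nth w 0 = Y.length + 2 ∧ Avoids ρ ∧ Avoids w ∧ Blocked g ρ ∧
      (∀ r, 1 ≤ r → r ≤ X.length → g r + 1 < Y.length + 2) ∧
      (∀ r, 1 ≤ r → r ≤ X.length → Allowed w (g r)) ∧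
      X = ρ.map (lower g) ∧ (n + 1) :: y :: Y = w.map (upper g X.length) ∧
      psi (X ++ (n + 1) :: y :: Y) = build (succLevel w ∘ g) ρ w := by
  obtain ⟨hp, hA⟩ := mem_avoiders.1 h
  obtain ⟨g, ρ, w, hg, hρ, hw, hw0, hgM, eX, eY⟩ := exists_build_max hp
  simp only [List.length_cons, add_assoc, Nat.reduceAdd] at hw hw0 hgM
  have eb : X ++ (n + 1) :: y :: Y = build g ρ w := by
    rw [build, hρ.length, ← eX, ← eY]
  rw [eb, avoids_build hg hρ hw hw0 hgM] at hA
  obtain ⟨hAρ, hAw, hB, hall⟩ := hA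
  have hgM' : ∀ r, 1 ≤ r → r ≤ X.length → g r + 1 < Y.length + 2 := by
    intro r h1 h2
    have hx : lower g r < y := hX _ (by
      rw [eX]; exact List.mem_map.2 ⟨r, hρ.mem_iff.2 ⟨h1, h2⟩, rfl⟩)
    have hy : nth ((n + 1) :: y :: Y) 1 = y := by simp [nth]
    rw [eY, nth_map _ _ (by rw [hw.length]; omega)] at hy
    rw [← hy, lower_lt_upper_iff hg h1 h2] at hx
    have := nth_lt_of_head hw hw0 (i := 1) (by omega) (by rw [hw.length]; omega)
    omega
  refine ⟨g, ρ, w, hg, hρ, hw, hw0, hAρ, hAw, hB, hgM', hall, eX, eY, ?_⟩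
  rw [eb]
  exact psi_build hg hρ hw hw0 (by omega) hAw hgM' hall

/-- Which left-to-right maxima are available for the map `φ`. -/
def Slot (n i : ℕ) (π : List ℕ) : Prop := 1 ≤ i ∧ (i ≤ lmax π ∨ n = 0 ∧ i = 1)

theorem lmax_nil : lmax [] = 0 := by simp [lmax_eq_rmax_reverse, rmax_nil]

theorem rmax_append_ge (u v : List ℕ) : rmax v ≤ rmax (u ++ v) := by
  induction u with
  | nil => rfl
  | cons a u ih => rw [List.cons_append, rmax_cons]; omega

theorem asc_cons_max {a : ℕ} {l : List ℕ} (h : ∀ x ∈ l, x < a) : asc (a :: l) = asc l := by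
  cases l with
  | nil => rw [asc_singleton, asc_nil]
  | cons b l =>
    have := asc_append (u := [a]) (v := b :: l) (by simp) (by simp)
    rw [List.singleton_append] at this
    rw [this, asc_singleton, if_neg (by simpa using (h b (by simp)).le)]
    omega

theorem avoids_cons_max {n : ℕ} {π : List ℕ} (hπ : π ∈ avoiders n) :
    (n + 1) :: π ∈ avoiders (n + 1) := by
  obtain ⟨hp, hA⟩ := mem_avoiders.1 hπ
  refine ⟨isPerm_insert (X := []) |>.2 hp, ?_⟩
  cases π with
  | nil =>
    refine (avoids_iff (w := [n + 1])).2 ⟨fun i j k l _ _ _ hl => ?_, fun i j l _ _ hl => ?_⟩ <;>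
      simp at hl <;> omega
  | cons y Y =>
    refine (avoids_insert (X := []) (by simp) fun x hx => ?_).2 hA
    have := (hp.mem_iff.1 hx).2
    omega

theorem insert_mem_avoiders {n y : ℕ} {X Y : List ℕ} (hX : ∀ x ∈ X, x < y) :
    X ++ (n + 1) :: y :: Y ∈ avoiders (n + 1) ↔ X ++ y :: Y ∈ avoiders n := by
  rw [mem_avoiders, mem_avoiders, isPerm_insert]
  refine and_congr_right fun hp => avoids_insert hX fun x hx => ?_
  have := (hp.mem_iff.1 hx).2
  omega

/-- The statistics depend only on the patterns of the two parts, which `ψ` preserves. The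
left-to-right maxima are those of the front part and the largest letter; the right-to-left maxima
lie in the rear part. For `i > 1` the ascent into `y` becomes the ascent into the largest letter.
Raised levels are positive, whence indecomposability. -/
theorem phi_spec {n i : ℕ} {π : List ℕ} (hπ : π ∈ avoiders n) (hi : Slot n i π) :
    phi i π ∈ avoiders (n + 1) ∧ Indec (phi i π) ∧ lmax (phi i π) = i ∧
      rmax (phi i π) = rmax π + 1 ∧ asc (phi i π) = asc π := by
  obtain ⟨hp, hA⟩ := mem_avoiders.1 hπ
  obtain ⟨hi1, hi2⟩ := hi
  rcases hi1.eq_or_lt with rfl | hi1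
  · rw [phi, if_pos rfl, hat_one hp]
    have hlt : ∀ x ∈ π, x < n + 1 := fun x hx => by
      have := (hp.mem_iff.1 hx).2
      omega
    refine ⟨avoids_cons_max hπ, indec_cons_max hp.length.le, ?_, ?_, asc_cons_max hlt⟩
    · have := lmax_append_max (u := []) (by simp) hlt
      rwa [lmax_nil] at this
    · rw [rmax_cons_max hlt, add_comm]
  · rw [phi, if_neg (by omega)]
    have hi3 : i ≤ lmax π := by omega
    obtain ⟨X, y, Y, hXne, rfl, e, hX, hl⟩ := hat_spec hp hi1 hi3
    rw [e]
    have hav := (insert_mem_avoiders (n := n) hX).2 hπ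
    obtain ⟨g, ρ, w, hg, hρ, hw, hw0, hAρ, hAw, hB, hgM, hall, eX, eY, epsi⟩ := psi_insert hav hX
    rw [epsi]
    have hn : n + 1 = X.length + (Y.length + 2) := by
      rw [← hav.1.length]; simp
    set g2 := succLevel w ∘ g with hg2def
    have hg2 : Monotone g2 := (succLevel_mono hw hw0).comp hg
    have hg2M : ∀ r, 1 ≤ r → r ≤ X.length → g2 r < Y.length + 2 := fun r h1 h2 =>
      succLevel_lt hw hw0 (hgM r h1 h2)
    have hperm := isPerm_build hg2 hρ hw fun r h1 h2 => (hg2M r h1 h2).le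
    have hmax := build_max hρ hw hw0 (by omega) hg2M
    have hρne : ρ.map (lower g2) ≠ [] := by
      intro h0
      have h1 := congrArg List.length h0
      rw [List.length_map, hρ.length, List.length_nil] at h1
      exact hXne (List.length_eq_zero_iff.1 h1)
    have hnd := hperm.nodup
    rw [hmax] at hnd
    have hnd' := List.nodup_append.1 hnd
    have hltL : ∀ x ∈ ρ.map (lower g2), x < X.length + (Y.length + 2) := by
      intro x hx
      have h1 := (hperm.mem_iff.1 (by rw [hmax]; simp [hx] :
        x ∈ build g2 ρ w)).2
      have h2 := hnd'.2.2 x hx _ List.mem_cons_self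
      omega
    have hltR : ∀ x ∈ w.tail.map (upper g2 X.length), x < X.length + (Y.length + 2) := by
      intro x hx
      have h0 : x ∈ build g2 ρ w := by
        rw [hmax]
        exact List.mem_append_right _ (List.mem_cons_of_mem _ hx)
      have h1 := (hperm.mem_iff.1 h0).2
      have h2 := (List.nodup_cons.1 hnd'.2.1).1
      have h3 : x ≠ X.length + (Y.length + 2) := fun e => h2 (e ▸ hx)
      omega
    have hwcons : (X.length + (Y.length + 2)) :: w.tail.map (upper g2 X.length) =
        w.map (upper g2 X.length) := by
      have := hmax
      rw [build, hρ.length] at this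
      exact (List.append_cancel_left this).symm
    have hyY : ∀ x ∈ y :: Y, x < n + 1 := fun x hx => by
      have := (hp.mem_iff.1 (List.mem_append_right X hx)).2
      omega
    have ermax : rmax w = rmax (y :: Y) + 1 := by
      rw [← rmax_map (w := w) ((upper_strictMono g X.length).strictMonoOn _), ← eY,
        rmax_cons_max hyY, add_comm]
    have easc : asc w = asc (y :: Y) := by
      rw [← asc_map (w := w) ((upper_strictMono g X.length).strictMonoOn _), ← eY,
        asc_cons_max hyY]
    refine ⟨⟨by rw [hn]; exact hperm, ?_⟩, ?_, ?_, ?_, ?_⟩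
    · refine (avoids_build hg2 hρ hw hw0 hg2M).2 ⟨hAρ, hAw, blocked_comp hB _, fun r _ _ => ?_⟩
      exact (succLevel_spec hw hw0 (g r)).2
    · exact indec_build hg2 hρ hw hw0 (by omega) hg2M fun r _ _ =>
        lt_of_le_of_lt (Nat.zero_le _) (succLevel_spec hw hw0 (g r)).1
    · rw [hmax, lmax_append_max hltL hltR, lmax_map ((lower_strictMono hg2).strictMonoOn _), ← hl,
        eX, lmax_map ((lower_strictMono hg).strictMonoOn _)]
    · rw [hmax, rmax_append_of_lt fun x hx => ⟨_, List.mem_cons_self, hltL x hx⟩, hwcons,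
        rmax_map ((upper_strictMono _ _).strictMonoOn _), ermax,
        rmax_append_of_lt fun x hx => ⟨y, by simp, hX x hx⟩]
    · rw [hmax, asc_append hρne (by simp), if_pos (by
          simpa using hltL _ (List.getLast_mem hρne)), hwcons,
        asc_map ((lower_strictMono hg2).strictMonoOn _),
        asc_map ((upper_strictMono _ _).strictMonoOn _), easc,
        asc_append hXne (by simp), if_pos (by simpa using hX _ (List.getLast_mem hXne))]
      congr 2
      rw [eX, asc_map ((lower_strictMono hg).strictMonoOn _)]

/-- The index is recovered as `lmax` of the image, the cut from the position of the largest letter,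
and the original levels from the raised ones because `succLevel w` is injective on allowed levels.
-/
theorem phi_inj {n i j : ℕ} {π π' : List ℕ} (hπ : π ∈ avoiders n) (hπ' : π' ∈ avoiders n)
    (hi : Slot n i π) (hj : Slot n j π') (h : phi i π = phi j π') : i = j ∧ π = π' := by
  have hij : i = j := by
    rw [← (phi_spec hπ hi).2.2.1, h, (phi_spec hπ' hj).2.2.1]
  subst hij
  refine ⟨rfl, ?_⟩
  have hp := hπ.1
  have hp' := hπ'.1
  obtain ⟨hi1, hi2⟩ := hi
  obtain ⟨-, hj2⟩ := hj
  rcases hi1.eq_or_lt with rfl | hi1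
  · rw [phi, phi, if_pos rfl, if_pos rfl, hat_one hp, hat_one hp'] at h
    exact List.tail_eq_of_cons_eq h
  · rw [phi, phi, if_neg (by omega), if_neg (by omega)] at h
    obtain ⟨X, y, Y, hXne, rfl, e, hX, hl⟩ := hat_spec hp hi1 (by omega)
    obtain ⟨X', y', Y', hXne', rfl, e', hX', hl'⟩ := hat_spec hp' hi1 (by omega)
    rw [e, e'] at h
    have hav := (insert_mem_avoiders (n := n) hX).2 hπ
    have hav' := (insert_mem_avoiders (n := n) hX').2 hπ'
    obtain ⟨g, ρ, w, hg, hρ, hw, hw0, -, -, -, hgM, hall, eX, eY, epsi⟩ := psi_insert hav hX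
    obtain ⟨g', ρ', w', hg', hρ', hw', hw0', -, -, -, hgM', hall', eX', eY', epsi'⟩ :=
      psi_insert hav' hX'
    have hn : n + 1 = X.length + (Y.length + 2) := by
      rw [← hav.1.length]; simp
    have hn' : n + 1 = X'.length + (Y'.length + 2) := by
      rw [← hav'.1.length]; simp
    rw [epsi, epsi'] at h
    have hg2 : Monotone (succLevel w ∘ g) := (succLevel_mono hw hw0).comp hg
    have hg2' : Monotone (succLevel w' ∘ g') := (succLevel_mono hw' hw0').comp hg'
    have hg2M : ∀ r, 1 ≤ r → r ≤ X.length → (succLevel w ∘ g) r < Y.length + 2 :=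
      fun r h1 h2 => succLevel_lt hw hw0 (hgM r h1 h2)
    have hg2M' : ∀ r, 1 ≤ r → r ≤ X'.length → (succLevel w' ∘ g') r < Y'.length + 2 :=
      fun r h1 h2 => succLevel_lt hw' hw0' (hgM' r h1 h2)
    have hlen : X.length = X'.length := by
      have h2 := h
      have hnd := (isPerm_build hg2 hρ hw fun r h1 h2 => (hg2M r h1 h2).le).nodup
      rw [build_max hρ hw hw0 (by omega) hg2M] at h2 hnd
      rw [build_max hρ' hw' hw0' (by omega) hg2M', ← hn', hn] at h2
      have hnd' := List.nodup_append.1 hnd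
      rw [eq_comm, List.append_cons_inj_of_notMem
        (fun hx => (List.nodup_append.1 (h2 ▸ hnd)).2.2 _ hx _ (by simp) rfl)
        (fun hx => (List.nodup_cons.1 (List.nodup_append.1 (h2 ▸ hnd)).2.1).1 hx)] at h2
      have h3 := congrArg List.length h2.1
      rw [List.length_map, List.length_map, hρ.length, hρ'.length] at h3
      exact h3.symm
    obtain ⟨rfl, rfl, hgg⟩ := build_inj hg2 hg2' hρ hw hρ' hw' hlen h
    have hgeq : ∀ r, 1 ≤ r → r ≤ X.length → g r = g' r := fun r h1 h2 =>
      succLevel_inj hw hw0 (hall r h1 h2) (hall' r h1 (hlen ▸ h2)) (hgg r h1 h2)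
    have eXX : X = X' := by
      rw [eX, eX']
      apply List.map_congr_left
      intro r hr
      rw [hρ.mem_iff] at hr
      unfold lower
      rw [hgeq r hr.1 hr.2]
    have eYY : (n + 1) :: y :: Y = (n + 1) :: y' :: Y' := by
      rw [eY, eY', ← hlen]
      apply List.map_congr_left
      intro q _
      exact upper_congr hgeq q
    rw [eXX, List.tail_eq_of_cons_eq eYY]

/-- Otherwise the first two letters and the later letter `ℓ + 1` form a 41-3 across `ℓ`. In
`phi_surj` this makes the letter behind the maximum a left-to-right maximum once the maximum is
removed. -/
theorem Allowed.lt_second {M : ℕ} {w : List ℕ} (h : IsPerm M w) (h0 : nth w 0 = M) {ℓ : ℕ}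
    (hℓ : Allowed w ℓ) (hM : ℓ + 1 < M) : ℓ < nth w 1 := by
  by_contra hc
  obtain ⟨k, hk, hkv⟩ := mem_iff_nth.1 (h.mem_iff.2 (⟨by omega, hM.le⟩ : 1 ≤ ℓ + 1 ∧ ℓ + 1 ≤ M))
  have hk0 : k ≠ 0 := fun e => by subst e; omega
  have hk1 : k ≠ 1 := fun e => by subst e; omega
  exact hℓ.2 0 k (by omega) hk ⟨not_lt.1 hc, by omega, by omega⟩

theorem lmax_insert_ge {X Y : List ℕ} {y : ℕ} (hX : ∀ x ∈ X, x < y) :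
    lmax X + 1 ≤ lmax (X ++ y :: Y) := by
  rw [lmax_eq_rmax_reverse, lmax_eq_rmax_reverse, List.reverse_append, List.reverse_cons,
    List.append_assoc]
  refine le_trans ?_ (rmax_append_ge _ _)
  rw [List.singleton_append, rmax_cons_max (by simpa using hX), add_comm]

theorem lmax_pos {X : List ℕ} (hX : X ≠ []) : 1 ≤ lmax X := by
  rw [lmax_eq_rmax_reverse]
  generalize hZ : X.reverse = Z
  have hne : Z ≠ [] := by simpa [← hZ] using hX
  clear hZ
  induction Z with
  | nil => exact absurd rfl hne
  | cons a Z ih =>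
    rw [rmax_cons]
    cases Z with
    | nil => simp
    | cons b Z => have := ih (by simp); omega

/-- If the largest letter comes first, delete it and take `i = 1`. Otherwise indecomposability makes
all levels positive; lower each to the previous allowed level, delete the largest letter, and `φ`
restores the permutation. -/
theorem phi_surj {n : ℕ} {π : List ℕ} (hπ : π ∈ avoiders (n + 1)) (hI : Indec π) :
    ∃ i π', π' ∈ avoiders n ∧ Slot n i π' ∧ phi i π' = π := by
  obtain ⟨hp, hA⟩ := mem_avoiders.1 hπ
  obtain ⟨X, Y, rfl⟩ := List.append_of_mem (hp.mem_iff.2 ⟨by omega, le_rfl⟩ : n + 1 ∈ π)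
  rcases eq_or_ne X [] with rfl | hXne
  · have hpY : IsPerm n Y := isPerm_insert (X := []) |>.1 hp
    refine ⟨1, Y, ⟨hpY, Avoids.of_append_right (u := [n + 1]) hA⟩, ⟨le_rfl, ?_⟩, ?_⟩
    · rcases eq_or_ne Y [] with rfl | hY
      · right; exact ⟨by simpa using hpY.length.symm, rfl⟩
      · left; exact lmax_pos hY
    · rw [phi, if_pos rfl, hat_one hpY]; rfl
  · obtain ⟨g, ρ, w, hg, hρ, hw, hw0, hgM, eX, eY⟩ := exists_build_max hp
    set M := Y.length + 1 with hMdef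
    have eb : X ++ (n + 1) :: Y = build g ρ w := by
      rw [build, hρ.length, ← eX, ← eY]
    rw [eb] at hA hI
    rw [avoids_build hg hρ hw hw0 hgM] at hA
    obtain ⟨hAρ, hAw, hB, hall⟩ := hA
    have hpos := pos_of_indec_build hg hρ hw (by omega) hB hI
    have hXl := List.length_pos_iff.2 hXne
    have hM2 : 2 ≤ M := by
      have h1 := hpos 1 le_rfl hXl
      have h2 := hgM 1 le_rfl hXl
      omega
    set g1 := predLevel w ∘ g with hg1def
    have hg1 : Monotone g1 := (predLevel_mono w).comp hg
    have hg1M : ∀ r, 1 ≤ r → r ≤ X.length → g1 r + 1 < M := fun r h1 h2 => by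
      have := predLevel_lt (w := w) (hpos r h1 h2)
      have := hgM r h1 h2
      simp only [hg1def, Function.comp]
      omega
    have hg1M' : ∀ r, 1 ≤ r → r ≤ X.length → g1 r < M := fun r h1 h2 => by
      have := hg1M r h1 h2
      omega
    have hall1 : ∀ r, 1 ≤ r → r ≤ X.length → Allowed w (g1 r) := fun r _ _ =>
      predLevel_allowed hw (g r)
    have hA1 : Avoids (build g1 ρ w) :=
      (avoids_build hg1 hρ hw hw0 hg1M').2 ⟨hAρ, hAw, blocked_comp hB _, hall1⟩
    have hpsi : psi (build g1 ρ w) = build g ρ w := by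
      rw [psi_build hg1 hρ hw hw0 (by omega) hAw hg1M hall1]
      exact build_congr w hρ fun r h1 h2 =>
        succLevel_predLevel hw hw0 (hall r h1 h2) (hpos r h1 h2)
    have hn : n + 1 = X.length + M := by
      rw [← hp.length]; simp [hMdef]
    have hp1 := isPerm_build hg1 hρ hw fun r h1 h2 => (hg1M' r h1 h2).le
    have hmax := build_max hρ hw hw0 (by omega) hg1M'
    rw [← hn] at hp1 hmax
    have htl : w.tail.length = M - 1 := by rw [List.length_tail, hw.length]
    obtain ⟨q, Z, hqZ⟩ : ∃ q Z, w.tail = q :: Z :=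
      List.exists_cons_of_length_pos (by omega)
    have hq : nth w 1 = q := by
      obtain ⟨m, w', rfl⟩ : ∃ m w', w = m :: w' := by
        cases w with
        | nil => simp at hqZ
        | cons m w' => exact ⟨m, w', rfl⟩
      rw [List.tail_cons] at hqZ
      simp [nth, hqZ]
    rw [hqZ, List.map_cons] at hmax
    set X1 := ρ.map (lower g1) with hX1def
    set y := upper g1 X.length q with hydef
    have hX1 : ∀ x ∈ X1, x < y := by
      intro x hx
      obtain ⟨r, hr, rfl⟩ := List.mem_map.1 hx
      rw [hρ.mem_iff] at hr
      refine lower_lt_upper hg1 hr.2 ?_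
      rw [← hq]
      exact (hall1 r hr.1 hr.2).lt_second hw hw0 (hg1M r hr.1 hr.2)
    have hX1ne : X1 ≠ [] := by
      intro h0
      have h1 := congrArg List.length h0
      rw [hX1def, List.length_map, hρ.length, List.length_nil] at h1
      omega
    have hmem : X1 ++ y :: Z.map (upper g1 X.length) ∈ avoiders n := by
      rw [← insert_mem_avoiders hX1, ← hmax]
      exact ⟨hp1, hA1⟩
    refine ⟨lmax X1 + 1, _, hmem, ⟨by omega, Or.inl (lmax_insert_ge hX1)⟩, ?_⟩
    have := lmax_pos hX1ne
    rw [phi, if_neg (by omega), hat_eq hmem.1 hX1, ← hmax, hpsi, eb]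

end PermWord

-- Direct sums and their unique decomposition.

namespace PermWord

theorem length_oplus (σ τ : List ℕ) : (oplus σ τ).length = σ.length + τ.length := by
  simp [oplus]

theorem oplus_lt {m k : ℕ} {σ τ : List ℕ} (hσ : IsPerm m σ) (hτ : IsPerm k τ) :
    ∀ x ∈ σ, ∀ y ∈ τ.map (· + σ.length), x < y := by
  intro x hx y hy
  obtain ⟨z, hz, rfl⟩ := List.mem_map.1 hy
  have h1 := (hσ.mem_iff.1 hx).2
  have h2 := (hτ.mem_iff.1 hz).1
  rw [hσ.length]
  omega

theorem oplus_mem_avoiders {m k : ℕ} {σ τ : List ℕ} (hσ : σ ∈ avoiders m) (hτ : τ ∈ avoiders k) :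
    oplus σ τ ∈ avoiders (m + k) := by
  have hlt := oplus_lt hσ.1 hτ.1
  have hs : StrictMono fun x : ℕ => x + σ.length := fun a b h => by simpa using h
  refine ⟨isPerm_of_length ?_ ?_ ?_, ?_⟩
  · unfold oplus
    rw [List.nodup_append]
    exact ⟨hσ.1.nodup, hτ.1.nodup.map hs.injective, fun x hx y hy => (hlt x hx y hy).ne⟩
  · rw [length_oplus, hσ.1.length, hτ.1.length]
  · intro x hx
    rcases List.mem_append.1 hx with hx | hx
    · have := hσ.1.mem_iff.1 hx
      omega
    · obtain ⟨y, hy, rfl⟩ := List.mem_map.1 hx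
      have := hτ.1.mem_iff.1 hy
      have := hσ.1.length
      omega
  · exact Avoids.append hσ.2 ((avoids_map (hs.strictMonoOn _)).2 hτ.2) hlt

theorem lmax_oplus {m k : ℕ} {σ τ : List ℕ} (hσ : IsPerm m σ) (hτ : IsPerm k τ) :
    lmax (oplus σ τ) = lmax σ + lmax τ := by
  rw [oplus, lmax_append (oplus_lt hσ hτ), lmax_map]
  exact fun a _ b _ h => by simpa using h

theorem rmax_oplus {m k : ℕ} {σ τ : List ℕ} (hσ : IsPerm m σ) (hτ : IsPerm k τ) (hne : τ ≠ []) :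
    rmax (oplus σ τ) = rmax τ := by
  obtain ⟨y, hy⟩ := List.exists_mem_of_ne_nil _ hne
  rw [oplus, rmax_append_of_lt fun x hx => ⟨y + σ.length, List.mem_map.2 ⟨y, hy, rfl⟩,
    oplus_lt hσ hτ x hx _ (List.mem_map.2 ⟨y, hy, rfl⟩)⟩, rmax_map]
  exact fun a _ b _ h => by simpa using h

theorem asc_oplus {m k : ℕ} {σ τ : List ℕ} (hσ : IsPerm m σ) (hτ : IsPerm k τ) (hne : σ ≠ [])
    (hne' : τ ≠ []) : asc (oplus σ τ) = asc σ + asc τ + 1 := by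
  have hne2 : τ.map (· + σ.length) ≠ [] := by simpa using hne'
  rw [oplus, asc_append hne hne2,
    if_pos (oplus_lt hσ hτ _ (List.getLast_mem hne) _ (List.head_mem hne2)), asc_map]
  exact fun a _ b _ h => by simpa using h

/-- If one first summand were shorter, it would be a proper prefix of the other one, and as a
permutation it would contradict the indecomposability of that one. -/
theorem oplus_inj {m m' : ℕ} {σ σ' τ τ' : List ℕ} (hσ : IsPerm m σ) (hσ' : IsPerm m' σ')
    (hI : Indec σ) (hI' : Indec σ') (hm : 0 < m)
    (hm' : 0 < m') (h : oplus σ τ = oplus σ' τ') : σ = σ' ∧ τ = τ' := by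
  have aux : ∀ {m m' : ℕ} {σ σ' τ τ' : List ℕ}, IsPerm m σ → IsPerm m' σ' → Indec σ' → 0 < m →
      oplus σ τ = oplus σ' τ' → m' ≤ m := by
    intro m m' σ σ' τ τ' hσ hσ' hI' hm h
    by_contra hc
    obtain ⟨x, hx, hlt⟩ := hI' m hm (by rw [hσ'.length]; omega)
    have e : σ'.take m = σ := by
      have h1 := congrArg (List.take m) h
      unfold oplus at h1
      rw [List.take_left' hσ.length, List.take_append_of_le_length (by rw [hσ'.length]; omega)]
        at h1
      exact h1.symm
    rw [e, hσ.mem_iff] at hx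
    omega
  have h1 := aux hσ hσ' hI' hm h
  have h2 := aux hσ' hσ hI hm' h.symm
  obtain rfl : m = m' := by omega
  obtain ⟨h3, h4⟩ := List.append_inj h (by rw [hσ.length, hσ'.length])
  subst h3
  exact ⟨rfl, List.map_injective_iff.2 (fun a b h => by simpa using h) h4⟩

theorem exists_oplus {n : ℕ} {π : List ℕ} (hπ : π ∈ avoiders n) (hI : ¬ Indec π) :
    ∃ m k σ τ, 0 < m ∧ 0 < k ∧ m + k = n ∧ σ ∈ avoiders m ∧ τ ∈ avoiders k ∧ π = oplus σ τ := by
  unfold Indec at hI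
  push Not at hI
  obtain ⟨j, hj, hjl, hle⟩ := hI
  have hp := hπ.1
  have hl := hp.length
  have hσ := isPerm_take hp hjl.le hle
  have hsplit := List.take_append_drop j π
  have hgt : ∀ x ∈ π.drop j, j < x ∧ x ≤ n := by
    intro x hx
    have h1 := hp.mem_iff.1 (List.mem_of_mem_drop hx)
    refine ⟨?_, h1.2⟩
    by_contra hc
    have h2 := hσ.mem_iff.2 (⟨h1.1, by omega⟩ : 1 ≤ x ∧ x ≤ j)
    have hnd := hp.nodup
    rw [← hsplit] at hnd
    exact (List.nodup_append.1 hnd).2.2 x h2 x hx rfl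
  have hmono : StrictMonoOn (fun x => x - j) {x | x ∈ π.drop j} := by
    intro a ha b hb hab
    have h1 := hgt a ha
    have h2 := hgt b hb
    simp only
    omega
  have hA : Avoids (π.take j ++ π.drop j) := by rw [hsplit]; exact hπ.2
  refine ⟨j, n - j, π.take j, (π.drop j).map (· - j), hj, by omega, by omega,
    ⟨hσ, hA.of_append_left⟩, ⟨?_, (avoids_map hmono).2 hA.of_append_right⟩, ?_⟩
  · apply isPerm_of_length
    · exact List.Nodup.map_on (fun a ha b hb e => hmono.injOn ha hb e)
        (hp.nodup.sublist (List.drop_sublist _ _))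
    · simp [hl]
    · intro x hx
      obtain ⟨y, hy, rfl⟩ := List.mem_map.1 hx
      have := hgt y hy
      omega
  · rw [oplus, hσ.length, List.map_map]
    conv_lhs => rw [← hsplit]
    congr 1
    conv_lhs => rw [← List.map_id (π.drop j)]
    apply List.map_congr_left
    intro x hx
    have := hgt x hx
    simp only [id, Function.comp]
    omega

theorem nil_mem_avoiders : [] ∈ avoiders 0 := ⟨by simp [IsPerm], avoids_nil⟩

end PermWord

-- The map `f`: statistics and bijectivity.

namespace LTree

mutual
/-- The number of edges of the right path. -/
def rpath : LTree → ℕ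
  | node _ cs => rpathForest cs
/-- The number of edges of the right path of the tree with the given list of subtrees. -/
def rpathForest : List LTree → ℕ
  | [] => 0
  | [c] => 1 + rpath c
  | _ :: d :: cs => rpathForest (d :: cs)
end

mutual
/-- The number of leaves. -/
def leaves : LTree → ℕ
  | node _ [] => 1
  | node _ (c :: cs) => leavesForest (c :: cs)
/-- The total number of leaves of a list of trees. -/
def leavesForest : List LTree → ℕ
  | [] => 0
  | c :: cs => leaves c + leavesForest cs
end

theorem isGood_node {a : ℕ} {cs : List LTree} : IsGood (node a cs) ↔
    (cs = [] ∧ a = 1 ∨ cs ≠ [] ∧ 1 ≤ a ∧ a ≤ labelSum cs) ∧ ∀ c ∈ cs, IsGood c := by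
  constructor
  · intro h
    cases h with
    | leaf => simp
    | node _ _ h1 h2 h3 h4 => exact ⟨Or.inr ⟨h1, h2, h3⟩, h4⟩
  · rintro ⟨⟨rfl, rfl⟩ | ⟨h1, h2, h3⟩, h4⟩
    · exact IsGood.leaf
    · exact IsGood.node a cs h1 h2 h3 h4

theorem isBeta_node {a : ℕ} {cs : List LTree} :
    IsBeta (node a cs) ↔ a = labelSum cs ∧ ∀ c ∈ cs, IsGood c := Iff.rfl

theorem labelSum_nil : labelSum [] = 0 := rfl

theorem labelSum_cons (c : LTree) (cs : List LTree) :
    labelSum (c :: cs) = c.label + labelSum cs := by simp [labelSum]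

theorem labelSum_append (cs ds : List LTree) :
    labelSum (cs ++ ds) = labelSum cs + labelSum ds := by simp [labelSum]

theorem sizeForest_append (cs ds : List LTree) :
    sizeForest (cs ++ ds) = sizeForest cs + sizeForest ds := by
  induction cs with
  | nil => simp [sizeForest]
  | cons c cs ih => simp [sizeForest, ih, add_assoc]

theorem size_pos (t : LTree) : 0 < t.size := by cases t; simp [size]

/-- What the map `φ` needs to know about a tree hanging from another one. -/
theorem slot_of_isGood {a : ℕ} {cs : List LTree} (h : IsGood (node a cs)) {π : List ℕ}
    (hl : PermWord.lmax π = labelSum cs) : PermWord.Slot (sizeForest cs) a π := by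
  rcases (isGood_node.1 h).1 with ⟨rfl, rfl⟩ | ⟨_, h2, h3⟩
  · exact ⟨le_rfl, Or.inr ⟨rfl, rfl⟩⟩
  · exact ⟨h2, Or.inl (hl ▸ h3)⟩

mutual
-- A subtree `t` is treated as `lam t.label` of the tree below, so its root contributes no letter to
-- `f t`; hence `t.size - 1`. The labelling rule at its root is the condition `Slot`.
theorem phi_f_spec : (t : LTree) → IsGood t →
    f t ∈ PermWord.avoiders (t.size - 1) ∧ PermWord.Slot (t.size - 1) t.label (f t) ∧
    PermWord.rmax (f t) = rpath t ∧ PermWord.asc (f t) + 1 = leaves t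
  | node a cs, h => by
    obtain ⟨h1, h2, h3, h4⟩ := fForest_spec cs (isGood_node.1 h).2
    simp only [f, size, Nat.add_sub_cancel_left, label, rpath]
    refine ⟨h1, slot_of_isGood h h2, h3, ?_⟩
    cases cs with
    | nil => simp [fForest, PermWord.asc_nil, leaves]
    | cons c cs => rw [leaves]; exact h4 (by simp)
theorem fForest_spec : (cs : List LTree) → (∀ c ∈ cs, IsGood c) →
    fForest cs ∈ PermWord.avoiders (sizeForest cs) ∧ PermWord.lmax (fForest cs) = labelSum cs ∧
    PermWord.rmax (fForest cs) = rpathForest cs ∧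
    (cs ≠ [] → PermWord.asc (fForest cs) + 1 = leavesForest cs)
  | [], _ => by
    simp [fForest, PermWord.nil_mem_avoiders, sizeForest, PermWord.lmax_nil, labelSum,
      PermWord.rmax_nil, rpathForest]
  | c :: cs, h => by
    obtain ⟨hc1, hc2, hc3, hc4⟩ := phi_f_spec c (h c (by simp))
    obtain ⟨h1, h2, h3, h4⟩ := fForest_spec cs fun d hd => h d (by simp [hd])
    obtain ⟨p1, -, p3, p4, p5⟩ := PermWord.phi_spec hc1 hc2
    have hs := size_pos c
    have hsz : c.size - 1 + 1 = c.size := by omega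
    rw [hsz] at p1
    have hne : PermWord.phi c.label (f c) ≠ [] := fun e => by
      have := p1.1.length
      rw [e, List.length_nil] at this
      omega
    rw [fForest, sizeForest, labelSum_cons]
    refine ⟨PermWord.oplus_mem_avoiders p1 h1, ?_, ?_, fun _ => ?_⟩
    · rw [PermWord.lmax_oplus p1.1 h1.1, p3, h2]
    · cases cs with
      | nil => simp [fForest, PermWord.oplus, p4, hc3, rpathForest, add_comm]
      | cons d cs =>
        have hne' : fForest (d :: cs) ≠ [] := fun e => by
          have := h1.1.length
          have := size_pos d
          rw [e, List.length_nil, sizeForest] at *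
          omega
        rw [PermWord.rmax_oplus p1.1 h1.1 hne', h3, rpathForest]
    · cases cs with
      | nil => simp [fForest, PermWord.oplus, p5, hc4, leavesForest]
      | cons d cs =>
        have hne' : fForest (d :: cs) ≠ [] := fun e => by
          have := h1.1.length
          have := size_pos d
          rw [e, List.length_nil, sizeForest] at *
          omega
        rw [PermWord.asc_oplus p1.1 h1.1 hne hne', p5, leavesForest, ← hc4, ← h4 (by simp)]
        ring
end

mutual
theorem eq_of_phi_f_eq : (t t' : LTree) → IsGood t → IsGood t' →
    PermWord.phi t.label (f t) = PermWord.phi t'.label (f t') → t = t'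
  | node a cs, node b ds, h, h', e => by
    obtain ⟨h1, h2, -, -⟩ := phi_f_spec _ h
    obtain ⟨h1', h2', -, -⟩ := phi_f_spec _ h'
    have hl := (PermWord.phi_spec h1 h2).1.1.length
    have hl' := (PermWord.phi_spec h1' h2').1.1.length
    rw [e, hl', Nat.add_right_cancel_iff] at hl
    rw [hl] at h1' h2'
    obtain ⟨rfl, hf⟩ := PermWord.phi_inj h1 h1' h2 h2' e
    simp only [f, label] at hf ⊢
    rw [eq_of_fForest_eq cs ds (isGood_node.1 h).2 (isGood_node.1 h').2 hf]
theorem eq_of_fForest_eq : (cs ds : List LTree) → (∀ c ∈ cs, IsGood c) → (∀ c ∈ ds, IsGood c) →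
    fForest cs = fForest ds → cs = ds
  | [], [], _, _, _ => rfl
  | [], d :: ds, _, h', e => by
    have h1 := (fForest_spec _ h').1.1.length
    rw [← e, fForest, List.length_nil, sizeForest] at h1
    have := size_pos d
    omega
  | c :: cs, [], h, _, e => by
    have h1 := (fForest_spec _ h).1.1.length
    rw [e, fForest, List.length_nil, sizeForest] at h1
    have := size_pos c
    omega
  | c :: cs, d :: ds, h, h', e => by
    obtain ⟨h1, h2, -, -⟩ := phi_f_spec c (h c (by simp))
    obtain ⟨h1', h2', -, -⟩ := phi_f_spec d (h' d (by simp))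
    obtain ⟨p1, p2, -⟩ := PermWord.phi_spec h1 h2
    obtain ⟨p1', p2', -⟩ := PermWord.phi_spec h1' h2'
    have hcs : ∀ x ∈ cs, IsGood x := fun x hx => h x (by simp [hx])
    have hds : ∀ x ∈ ds, IsGood x := fun x hx => h' x (by simp [hx])
    rw [fForest, fForest] at e
    obtain ⟨e1, e2⟩ := PermWord.oplus_inj p1.1 p1'.1 p2 p2' (by omega) (by omega) e
    rw [eq_of_phi_f_eq c d (h c (by simp)) (h' d (by simp)) e1, eq_of_fForest_eq cs ds hcs hds e2]
end

/-- Strong induction: an indecomposable avoider comes from `phi_surj` and gives a single subtree, a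
decomposable one gives a concatenation of forests. -/
theorem exists_fForest_eq (n : ℕ) : ∀ π ∈ PermWord.avoiders n,
    ∃ cs : List LTree, (∀ c ∈ cs, IsGood c) ∧ fForest cs = π := by
  induction n using Nat.strong_induction_on with
  | _ n ih =>
    intro π hπ
    by_cases hI : PermWord.Indec π
    · cases n with
      | zero =>
        refine ⟨[], by simp, ?_⟩
        rw [fForest]
        exact (List.length_eq_zero_iff.1 hπ.1.length).symm
      | succ n =>
        obtain ⟨i, π', hπ', ⟨hi, hi'⟩, rfl⟩ := PermWord.phi_surj hπ hI
        obtain ⟨cs, hcs, rfl⟩ := ih n (by omega) π' hπ'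
        obtain ⟨h1, h2, -, -⟩ := fForest_spec cs hcs
        have hn : n = sizeForest cs := by rw [← hπ'.1.length, h1.1.length]
        refine ⟨[node i cs], ?_, by simp [fForest, PermWord.oplus, label, f]⟩
        rw [List.forall_mem_singleton, isGood_node]
        refine ⟨?_, hcs⟩
        cases cs with
        | nil =>
          rw [h2, labelSum_nil] at hi'
          exact Or.inl ⟨rfl, by omega⟩
        | cons c cs =>
          have := size_pos c
          rw [sizeForest] at hn
          exact Or.inr ⟨by simp, hi, by rw [← h2]; omega⟩
    · obtain ⟨m, k, σ, τ, hm, hk, hmk, hσ, hτ, rfl⟩ := PermWord.exists_oplus hπ hI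
      obtain ⟨cs, hcs, rfl⟩ := ih m (by omega) σ hσ
      obtain ⟨ds, hds, rfl⟩ := ih k (by omega) τ hτ
      refine ⟨cs ++ ds, fun c hc => ?_, fForest_append cs ds⟩
      exact (List.mem_append.1 hc).elim (hcs c) (hds c)

theorem bijOn_f (n : ℕ) : Set.BijOn f (betaTrees (n + 1)) (PermWord.avoiders n) := by
  refine ⟨?_, ?_, ?_⟩
  · rintro ⟨a, cs⟩ ⟨h1, h2⟩
    rw [size, add_comm, Nat.add_right_cancel_iff] at h2
    subst h2
    exact (fForest_spec cs (isBeta_node.1 h1).2).1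
  · rintro ⟨a, cs⟩ ⟨h1, -⟩ ⟨b, ds⟩ ⟨h2, -⟩ e
    rw [isBeta_node] at h1 h2
    have := eq_of_fForest_eq cs ds h1.2 h2.2 e
    subst this
    rw [h1.1, h2.1]
  · intro π hπ
    obtain ⟨cs, hcs, rfl⟩ := exists_fForest_eq n π hπ
    refine ⟨node (labelSum cs) cs, ⟨isBeta_node.2 ⟨rfl, hcs⟩, ?_⟩, rfl⟩
    rw [size, ← (fForest_spec cs hcs).1.1.length, hπ.1.length, add_comm]

end LTree

-- The map `h`: preservation of the labelling rules, and tree statistics.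

namespace LTree

theorem rpathForest_concat (cs : List LTree) (c : LTree) :
    rpathForest (cs ++ [c]) = 1 + rpath c := by
  induction cs with
  | nil => simp [rpathForest]
  | cons d cs ih => cases cs <;> simp_all [rpathForest]

theorem leavesForest_append (cs ds : List LTree) :
    leavesForest (cs ++ ds) = leavesForest cs + leavesForest ds := by
  induction cs with
  | nil => simp [leavesForest]
  | cons c cs ih => simp [leavesForest, ih, add_assoc]

theorem leaves_node {a : ℕ} {cs : List LTree} (h : cs ≠ []) :
    leaves (node a cs) = leavesForest cs := by
  cases cs with
  | nil => exact absurd rfl h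
  | cons c cs => rw [leaves]

theorem IsGood.label_pos {t : LTree} (h : IsGood t) : 1 ≤ t.label := by
  cases h with
  | leaf => exact le_rfl
  | node a cs _ h2 => exact h2

theorem obslash_node {a : ℕ} {cs : List LTree} (hcs : cs ≠ []) (v : LTree) :
    obslash (node a cs) v = node a (obslashForest cs v) := by
  cases cs with
  | nil => exact absurd rfl hcs
  | cons c cs => rw [obslash]

theorem gam_concat (i a : ℕ) (cs : List LTree) (c : LTree) :
    gam (i + 2) (node a (cs ++ [c])) = node (a + 1) (cs ++ [gam (i + 1) c]) := by
  simp [gam]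

theorem gam_one_leaf : gam 1 leaf = node 1 [node 1 []] := by simp [gam, leaf]

/-- The effect of `gam` if the new leaf is attached to an internal node. -/
theorem gam_spec : ∀ (i : ℕ) (cs : List LTree), (∀ c ∈ cs, IsGood c) → i + 1 ≤ rpathForest cs →
    ∃ ds, ds ≠ [] ∧ (∀ x, gam (i + 1) (node x cs) = node (x + 1) ds) ∧ (∀ d ∈ ds, IsGood d) ∧
      labelSum ds = labelSum cs + 1 ∧ sizeForest ds = sizeForest cs + 1 ∧
      leavesForest ds = leavesForest cs + 1 ∧ rpathForest ds = i + 1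
  | 0, cs, hcs, _ => by
    refine ⟨cs ++ [node 1 []], by simp, fun x => by rw [gam], ?_, ?_, ?_, ?_, ?_⟩
    · intro d hd
      rcases List.mem_append.1 hd with hd | hd
      · exact hcs d hd
      · rw [List.mem_singleton.1 hd]; exact IsGood.leaf
    · simp [labelSum_append, labelSum_cons, labelSum_nil, label]
    · simp [sizeForest_append, sizeForest, size]
    · simp [leavesForest_append, leavesForest, leaves]
    · simp [rpathForest_concat, rpath, rpathForest]
  | i + 1, cs, hcs, hi => by
    rcases List.eq_nil_or_concat' cs with rfl | ⟨es, ⟨b, c⟩, rfl⟩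
    · simp [rpathForest] at hi
    rw [rpathForest_concat, rpath] at hi
    have hg := hcs (node b c) (by simp)
    have hc : c ≠ [] := by
      rintro rfl
      simp [rpathForest] at hi
    have hg' := isGood_node.1 hg
    obtain ⟨ds, hne, h1, h2, h3, h4, h5, h6⟩ := gam_spec i c hg'.2 (by omega)
    refine ⟨es ++ [node (b + 1) ds], by simp, fun x => by rw [gam_concat, h1], ?_, ?_, ?_, ?_, ?_⟩
    · intro d hd
      rcases List.mem_append.1 hd with hd | hd
      · exact hcs d (by simp [hd])
      · rw [List.mem_singleton.1 hd, isGood_node]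
        refine ⟨Or.inr ⟨hne, by omega, ?_⟩, h2⟩
        rcases hg'.1 with ⟨h, -⟩ | ⟨-, -, h⟩
        · exact absurd h hc
        · omega
    · simp [labelSum_append, labelSum_cons, labelSum_nil, label]; omega
    · simp [sizeForest_append, sizeForest, size, h4]; omega
    · simp [leavesForest_append, leavesForest, leaves_node hne, leaves_node hc, h5]; omega
    · rw [rpathForest_concat, rpath, h6]; omega

mutual
-- The leaf that is replaced already had label `1`, so no rule above it is affected, and `1` is
-- admissible at the new internal node. One node and one leaf are lost, and the right paths are
-- joined end to end.
theorem obslash_spec : (c v : LTree) → IsGood c → IsBeta v → v.children ≠ [] →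
    IsGood (obslash c v) ∧ (obslash c v).label = c.label ∧
    (obslash c v).size + 1 = c.size + v.size ∧
    (obslash c v).leaves + 1 = c.leaves + v.leaves ∧
    (obslash c v).rpath = c.rpath + v.rpath
  | node a [], node b ds, h, hv, hne => by
    simp only [children] at hne
    rw [isBeta_node] at hv
    obtain ⟨rfl, hds⟩ := hv
    obtain rfl : a = 1 := by
      rcases (isGood_node.1 h).1 with h | h
      · exact h.2
      · exact absurd rfl h.1
    have hpos : 1 ≤ labelSum ds := by
      cases ds with
      | nil => exact absurd rfl hne
      | cons d ds =>
        have := (hds d (by simp)).label_pos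
        rw [labelSum_cons]; omega
    simp only [obslash, setLabel, label, size, sizeForest, rpath, rpathForest, leaves_node hne]
    refine ⟨isGood_node.2 ⟨Or.inr ⟨hne, le_rfl, hpos⟩, hds⟩, trivial, by omega, ?_, by omega⟩
    rw [leaves]; omega
  | node a (c :: cs), v, h, hv, hne => by
    obtain ⟨h1, h2, h3, h4, h5, h6⟩ :=
      obslashForest_spec (c :: cs) v (by simp) (isGood_node.1 h).2 hv hne
    rw [obslash]
    simp only [label, size, rpath, leaves_node h1, leaves_node (List.cons_ne_nil c cs)]
    refine ⟨isGood_node.2 ⟨Or.inr ⟨h1, ?_⟩, h2⟩, trivial, by omega, h5, h6⟩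
    rcases (isGood_node.1 h).1 with h | h
    · exact absurd h.1 (by simp)
    · rw [h3]; exact h.2
theorem obslashForest_spec : (cs : List LTree) → (v : LTree) → cs ≠ [] → (∀ c ∈ cs, IsGood c) →
    IsBeta v → v.children ≠ [] →
    obslashForest cs v ≠ [] ∧ (∀ c ∈ obslashForest cs v, IsGood c) ∧
    labelSum (obslashForest cs v) = labelSum cs ∧
    sizeForest (obslashForest cs v) + 1 = sizeForest cs + v.size ∧
    leavesForest (obslashForest cs v) + 1 = leavesForest cs + v.leaves ∧
    rpathForest (obslashForest cs v) = rpathForest cs + v.rpath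
  | [], _, h, _, _, _ => absurd rfl h
  | [c], v, _, hc, hv, hne => by
    obtain ⟨h1, h2, h3, h4, h5⟩ := obslash_spec c v (hc c (by simp)) hv hne
    simp only [obslashForest, labelSum_cons, labelSum_nil, sizeForest, leavesForest, rpathForest]
    refine ⟨by simp, by simpa using h1, by omega, by omega, by omega, by omega⟩
  | c :: d :: cs, v, _, hc, hv, hne => by
    obtain ⟨h1, h2, h3, h4, h5, h6⟩ :=
      obslashForest_spec (d :: cs) v (by simp) (fun x hx => hc x (by simp [hx])) hv hne
    rw [obslashForest, labelSum_cons, sizeForest, leavesForest, h3, labelSum_cons c (d :: cs)]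
    refine ⟨by simp, ?_, rfl, ?_, ?_, ?_⟩
    · intro x hx
      rcases List.mem_cons.1 hx with rfl | hx
      · exact hc x (by simp)
      · exact h2 x hx
    · rw [sizeForest]; omega
    · rw [leavesForest]; omega
    · rw [rpathForest, ← h6]
      obtain ⟨e, es, he⟩ := List.exists_cons_of_ne_nil h1
      rw [he, rpathForest]
end

/-- `gam`, applied as in the definition of `h`. -/
theorem gam_hForest_spec {a : ℕ} {cs ds : List LTree} (hc : IsGood (node a cs))
    (hds : ∀ d ∈ ds, IsGood d) (hr : rpathForest ds = labelSum cs)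
    (hs : sizeForest ds = sizeForest cs) {x : ℕ} (hx : x = labelSum ds) :
    ∃ es, es ≠ [] ∧ gam a (node x ds) = node (x + 1) es ∧ (∀ d ∈ es, IsGood d) ∧
      x + 1 = labelSum es ∧ sizeForest es = sizeForest ds + 1 ∧
      (leavesForest es = leavesForest ds + 1) ∧ rpathForest es = a := by
  rcases (isGood_node.1 hc).1 with ⟨rfl, rfl⟩ | ⟨h1, h2, h3⟩
  · obtain rfl : ds = [] := by
      cases ds with
      | nil => rfl
      | cons d ds =>
        have := size_pos d
        simp [sizeForest] at hs
        omega
    refine ⟨[node 1 []], by simp, by simp [gam], by simpa using IsGood.leaf, ?_, ?_, ?_, ?_⟩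
    · simp [hx, labelSum, label]
    · simp [sizeForest, size]
    · simp [leavesForest, leaves]
    · simp [rpathForest, rpath]
  · obtain ⟨i, rfl⟩ : ∃ i, a = i + 1 := ⟨a - 1, by omega⟩
    obtain ⟨es, e1, e2, e3, e4, e5, e6, e7⟩ := gam_spec i ds hds (by omega)
    exact ⟨es, e1, e2 x, e3, by omega, e5, e6, e7⟩

mutual
-- `lam a` sets the root label to `a` and lengthens the right path by one, while `gam a` does the
-- opposite; `oplus` adds labels and `obslash` adds right paths. A step `lam` adds an internal node
-- to a tree with an edge where `gam` adds a leaf to its image, so leaves on the two sides keep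
-- adding up to the size.
theorem h_spec : (t : LTree) → IsGood t →
    ∃ x ds, h t = node x ds ∧ (∀ d ∈ ds, IsGood d) ∧ x = labelSum ds ∧
      sizeForest ds + 1 = t.size ∧ leavesForest ds + t.leaves = t.size ∧
      rpathForest ds = labelSum t.children ∧ x = t.rpath
  | node a cs, hg => by
    obtain ⟨x, ds, h1, h2, h3, h4, h5, h6, h7⟩ := hForest_spec cs (isGood_node.1 hg).2
    refine ⟨x, ds, by rw [h, h1], h2, h3, by rw [size]; omega, ?_, h6, by rw [rpath]; omega⟩
    cases cs with
    | nil =>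
      rw [sizeForest] at h4
      obtain rfl : ds = [] := by
        cases ds with
        | nil => rfl
        | cons d ds =>
          have := size_pos d
          simp [sizeForest] at h4
          omega
      simp [leavesForest, leaves, size, sizeForest]
    | cons c cs =>
      rw [leaves_node (by simp), size]
      have := h5 (by simp)
      omega
theorem hForest_spec : (cs : List LTree) → (∀ c ∈ cs, IsGood c) →
    ∃ x ds, hForest cs = node x ds ∧ (∀ d ∈ ds, IsGood d) ∧ x = labelSum ds ∧
      sizeForest ds = sizeForest cs ∧
      (cs ≠ [] → leavesForest ds + leavesForest cs = 1 + sizeForest cs) ∧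
      rpathForest ds = labelSum cs ∧ x = rpathForest cs
  | [], _ => ⟨0, [], by simp [hForest, leaf, labelSum, rpathForest, sizeForest]⟩
  | [node a cs], hc => by
    have hg := hc (node a cs) (by simp)
    obtain ⟨x, ds, h1, h2, h3, h4, h5, h6, h7⟩ := h_spec (node a cs) hg
    rw [size] at h4 h5
    obtain ⟨es, e1, e2, e3, e4, e5, e6, e7⟩ := gam_hForest_spec hg h2 h6 (by omega) h3
    refine ⟨x + 1, es, by rw [hForest, h1]; exact e2, e3, e4, ?_, fun _ => ?_, ?_, ?_⟩
    · simp only [sizeForest, size]; omega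
    · simp only [leavesForest, sizeForest, size]; omega
    · simp only [labelSum_cons, labelSum_nil, label]; omega
    · simp only [rpathForest]; omega
  | node a cs :: d :: ds, hc => by
    have hg := hc (node a cs) (by simp)
    obtain ⟨x, xs, h1, h2, h3, h4, h5, h6, h7⟩ := h_spec (node a cs) hg
    rw [size] at h4 h5
    obtain ⟨es, e1, e2, e3, e4, e5, e6, e7⟩ := gam_hForest_spec hg h2 h6 (by omega) h3
    obtain ⟨y, ys, k1, k2, k3, k4, k5, k6, k7⟩ :=
      hForest_spec (d :: ds) fun c hx => hc c (by simp [hx])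
    have hys : ys ≠ [] := by
      rintro rfl
      have := size_pos d
      simp only [sizeForest] at k4
      omega
    obtain ⟨o1, o2, o3, o4, o5, o6⟩ := obslashForest_spec ys (node (x + 1) es) hys k2
      (isBeta_node.2 ⟨e4, e3⟩) e1
    have hob : obslash (node y ys) (node (x + 1) es) =
        node y (obslashForest ys (node (x + 1) es)) := obslash_node hys _
    rw [leaves_node e1] at o5
    rw [size] at o4
    rw [rpath] at o6
    have := k5 (by simp)
    refine ⟨y, obslashForest ys (node (x + 1) es), ?_, o2, by omega, ?_, fun _ => ?_, ?_, ?_⟩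
    · rw [hForest, h1, k1, ← hob, ← e2]; rfl
    · rw [sizeForest, size]; omega
    · rw [leavesForest, sizeForest, size]; omega
    · rw [labelSum_cons, label]; omega
    · rw [rpathForest]; omega
end

/-! The map `h` is an involution. -/

theorem obslash_oplus (u v w : LTree) (hv : v.children ≠ []) :
    obslash (oplus u v) w = oplus u (obslash v w) := by
  obtain ⟨a, us⟩ := u
  obtain ⟨b, vs⟩ := v
  simp only [children] at hv
  obtain ⟨c, cs, rfl⟩ := List.exists_cons_of_ne_nil hv
  have key : ∀ us : List LTree, obslashForest (us ++ c :: cs) w =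
      us ++ obslashForest (c :: cs) w := by
    intro us
    induction us with
    | nil => rfl
    | cons d us ih => cases us <;> simp_all [obslashForest]
  simp only [oplus, label, children]
  rw [obslash_node (by simp), obslash_node (by simp), key]

theorem gam_oplus (i : ℕ) (u v : LTree) (hv : v.children ≠ []) :
    gam (i + 1) (oplus u v) = oplus u (gam (i + 1) v) := by
  obtain ⟨a, us⟩ := u
  obtain ⟨b, vs⟩ := v
  simp only [children] at hv
  cases i with
  | zero => simp [oplus, gam, label, children, add_assoc]
  | succ i =>
    rcases List.eq_nil_or_concat' vs with rfl | ⟨es, c, rfl⟩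
    · exact absurd rfl hv
    · simp only [oplus, label, children, gam_concat]
      rw [← List.append_assoc, gam_concat]
      simp [add_assoc]

theorem children_hForest_ne_nil {cs : List LTree} (h : ∀ c ∈ cs, IsGood c) (hne : cs ≠ []) :
    (hForest cs).children ≠ [] := by
  obtain ⟨x, ds, h1, -, -, h4, -⟩ := hForest_spec cs h
  rw [h1, children]
  rintro rfl
  obtain ⟨c, cs, rfl⟩ := List.exists_cons_of_ne_nil hne
  have := size_pos c
  simp only [sizeForest] at h4
  omega

mutual
-- The mirror image of the rule for `oplus`, by recursion on `u`; it rests on `obslash` and `gam`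
-- acting only in the last summand of a sum.
theorem h_obslash : (u v : LTree) → IsGood u → u.children ≠ [] → v.children ≠ [] →
    h (obslash u v) = oplus (h v) (h u)
  | node _ [], _, _, hu, _ => absurd rfl hu
  | node a (c :: cs), v, hg, _, hv => by
    rw [obslash, h, h, hForest_obslashForest (c :: cs) v (isGood_node.1 hg).2 (by simp) hv]
theorem hForest_obslashForest : (cs : List LTree) → (v : LTree) → (∀ c ∈ cs, IsGood c) →
    cs ≠ [] → v.children ≠ [] → hForest (obslashForest cs v) = oplus (h v) (hForest cs)
  | [], _, _, hu, _ => absurd rfl hu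
  -- Here `u` is `lam 1 leaf`, attaching `v` yields `lam 1 v`, and `gam 1` adds a summand `lam 1
  -- leaf` on the right.
  | [node a []], v, hg, _, hv => by
    obtain rfl : a = 1 := by
      rcases (isGood_node.1 (hg (node a []) (by simp))).1 with h | h
      · exact h.2
      · exact absurd rfl h.1
    have hl : h (node 1 []) = leaf := by simp [h, hForest]
    rw [obslashForest, obslash, hForest, hForest, hl, label, h_setLabel, gam_one_leaf]
    obtain ⟨b, vs⟩ := v
    simp only [setLabel, label]
    generalize h (node b vs) = t
    obtain ⟨c, ts⟩ := t
    simp [gam, oplus, label, children]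
  | [node a (c :: cs)], v, hg, _, hv => by
    have hg1 := hg (node a (c :: cs)) (by simp)
    have ih := h_obslash (node a (c :: cs)) v hg1 (by simp [children]) hv
    have hlab : (obslash (node a (c :: cs)) v).label = a := by rw [obslash, label]
    have hpos := hg1.label_pos
    rw [label] at hpos
    obtain ⟨i, rfl⟩ : ∃ i, a = i + 1 := ⟨a - 1, by omega⟩
    rw [obslashForest, hForest, hForest, hlab, ih, label, gam_oplus]
    rw [h]
    exact children_hForest_ne_nil (isGood_node.1 hg1).2 (by simp)
  | c :: d :: cs, v, hg, _, hv => by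
    have hg' : ∀ x ∈ d :: cs, IsGood x := fun x hx => hg x (by simp [hx])
    have ih := hForest_obslashForest (d :: cs) v hg' (by simp) hv
    have hne : obslashForest (d :: cs) v ≠ [] := by cases cs <;> simp [obslashForest]
    rw [obslashForest]
    obtain ⟨e, es, he⟩ := List.exists_cons_of_ne_nil hne
    rw [he] at ih ⊢
    rw [hForest, ih, obslash_oplus _ _ _ (children_hForest_ne_nil hg' (by simp)), hForest]
end

theorem obslash_lam (i : ℕ) (y z : LTree) (hy : y.children ≠ []) :
    obslash (lam i y) z = lam i (obslash y z) := by
  obtain ⟨a, ys⟩ := y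
  simp only [children] at hy
  obtain ⟨c, cs, rfl⟩ := List.exists_cons_of_ne_nil hy
  simp [lam, setLabel, obslash, obslashForest]

/-- For the index `1`, `gam 1 t` is `t ⊕ lam 1 leaf`. For a larger index, `gam` works inside the
last subtree and raises its root label, and the induction closes by the commutation `gam (b + 1)
(lam (i + 1) s) = lam (i + 2) (gam b s)`. -/
theorem h_gam : ∀ (i a : ℕ) (cs : List LTree), (∀ c ∈ cs, IsGood c) →
    (i = 0 ∨ i + 1 ≤ rpathForest cs) → h (gam (i + 1) (node a cs)) = lam (i + 1) (hForest cs)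
  | 0, a, cs, hcs, _ => by
    have hone : hForest [node 1 []] = node 1 [node 1 []] := by
      simp [hForest, label, h, gam, leaf]
    rw [gam, h]
    rcases eq_or_ne cs [] with rfl | hne
    · rw [List.nil_append, hone]
      simp [hForest, lam, leaf, setLabel]
    · rw [hForest_append _ _ hne (by simp), hone]
      simp [obslash, obslashForest, lam]
  | i + 1, a, cs, hcs, hi => by
    have hi : i + 2 ≤ rpathForest cs := by omega
    rcases List.eq_nil_or_concat' cs with rfl | ⟨es, ⟨b, ds⟩, rfl⟩
    · simp [rpathForest] at hi
    rw [rpathForest_concat, rpath] at hi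
    have hg := hcs (node b ds) (by simp)
    have hds : ds ≠ [] := by
      rintro rfl
      simp [rpathForest] at hi
    have hg' := isGood_node.1 hg
    have ih := h_gam i b ds hg'.2 (by omega)
    obtain ⟨k, hb, hbl⟩ : ∃ k, b = k + 1 ∧ k + 1 ≤ labelSum ds := by
      rcases hg'.1 with h | h
      · exact absurd h.1 hds
      · exact ⟨b - 1, by omega, by omega⟩
    obtain ⟨x, xs, x1, x2, x3, x4, -, x6, x7⟩ := hForest_spec ds hg'.2
    obtain ⟨ws, w1, w2, -⟩ := gam_spec k xs x2 (by omega)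
    obtain ⟨gs, g1, g2, -⟩ := gam_spec i ds hg'.2 (by omega)
    have hsingle : hForest [gam (i + 1) (node b ds)] = lam (i + 2) (hForest [node b ds]) := by
      have hlab : (gam (i + 1) (node b ds)).label = k + 2 := by rw [g2, label, hb]
      rw [hForest, hlab, ih, hForest, label, h, x1, hb, w2]
      -- This is the commutation of `gam` with `lam`: descending through the new root shifts the
      -- index of `gam` by one and raises the label of `lam` by one.
      have := gam_concat k (i + 1) [] (node (i + 1) xs)
      rw [w2] at this
      simpa [lam, setLabel] using this
    rw [gam_concat, h]
    rcases eq_or_ne es [] with rfl | hne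
    · rw [List.nil_append, List.nil_append, hsingle]
    · rw [hForest_append _ _ hne (by simp), hForest_append _ _ hne (by simp), hsingle,
        obslash_lam]
      exact children_hForest_ne_nil (by simpa using hg) (by simp)

theorem h_obslash_of_children {u v : LTree} (hg : ∀ c ∈ u.children, IsGood c)
    (hu : u.children ≠ []) (hv : v.children ≠ []) : h (obslash u v) = oplus (h v) (h u) := by
  obtain ⟨a, us⟩ := u
  simp only [children] at hg hu
  have := hForest_obslashForest us v hg hu hv
  obtain ⟨c, cs, rfl⟩ := List.exists_cons_of_ne_nil hu
  rw [obslash, h, h, this]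

theorem h_gam_label {c : LTree} (hc : IsGood c)
    (hh : h (h c) = node (labelSum c.children) c.children) :
    h (gam c.label (h c)) = node c.label [c] := by
  obtain ⟨x, ds, h1, h2, h3, h4, h5, h6, h7⟩ := h_spec c hc
  obtain ⟨a, cs⟩ := c
  rw [h1, h, children] at hh
  rw [children] at h6
  have hg := (isGood_node.1 hc).1
  have hpos := hc.label_pos
  rw [label] at hpos
  obtain ⟨k, rfl⟩ : ∃ k, a = k + 1 := ⟨a - 1, by omega⟩
  rw [h1, label, h_gam k x ds h2 (by omega), hh]
  simp [lam, setLabel]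

mutual
-- As `h` forgets the root label of a hanging subtree, `h ∘ h` returns the subtree with the root
-- label of a beta(1,0)-tree; the original label is put back by the surrounding `lam`.
theorem h_h : (t : LTree) → IsGood t → h (h t) = node (labelSum t.children) t.children
  | node a cs, hg => by
    rw [h, h_hForest cs (isGood_node.1 hg).2]; rfl
theorem h_hForest : (cs : List LTree) → (∀ c ∈ cs, IsGood c) →
    h (hForest cs) = node (labelSum cs) cs
  | [], _ => by simp [hForest, leaf, h, labelSum]
  | [c], hg => by
    have hc := hg c (by simp)
    rw [hForest, h_gam_label hc (h_h c hc), labelSum_cons, labelSum_nil, add_zero]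
  | c :: d :: cs, hg => by
    have hc := hg c (by simp)
    have hg' : ∀ x ∈ d :: cs, IsGood x := fun x hx => hg x (List.mem_cons_of_mem _ hx)
    have ih := h_hForest (d :: cs) hg'
    have hne := children_hForest_ne_nil hg' (by simp)
    have hne2 : (gam c.label (h c)).children ≠ [] := by
      have := children_hForest_ne_nil (cs := [c]) (by simpa using hc) (by simp)
      rwa [hForest] at this
    have hgc : ∀ x ∈ (hForest (d :: cs)).children, IsGood x := by
      obtain ⟨y, ys, k1, k2, -⟩ := hForest_spec (d :: cs) hg'
      rw [k1]; exact k2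
    rw [hForest, h_obslash_of_children hgc hne hne2, ih, h_gam_label hc (h_h c hc),
      labelSum_cons c]
    rfl
end

theorem mapsTo_h (n : ℕ) : Set.MapsTo h (betaTrees (n + 1)) (betaTrees (n + 1)) := by
  rintro ⟨a, cs⟩ ⟨hb, hs⟩
  obtain ⟨x, ds, h1, h2, h3, h4, -⟩ := hForest_spec cs (isBeta_node.1 hb).2
  rw [h, h1]
  refine ⟨isBeta_node.2 ⟨h3, h2⟩, ?_⟩
  rw [size] at hs ⊢
  omega

theorem h_h_of_isBeta {t : LTree} (ht : IsBeta t) : h (h t) = t := by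
  obtain ⟨a, cs⟩ := t
  rw [isBeta_node] at ht
  rw [h, h_hForest cs ht.2, ht.1]

/-- The statistics of the permutation attached to a tree, and of the one attached to its image
under `h`. -/
theorem stats_f_h {n : ℕ} {t : LTree} (ht : t ∈ betaTrees (n + 1)) :
    PermWord.asc (f t) = PermWord.des (f (h t)) ∧ PermWord.lmax (f t) = PermWord.rmax (f (h t)) ∧
    PermWord.rmax (f t) = PermWord.lmax (f (h t)) := by
  obtain ⟨a, cs⟩ := t
  obtain ⟨hb, hs⟩ := ht
  obtain ⟨x, ds, h1, h2, h3, h4, h5, h6, h7⟩ := hForest_spec cs (isBeta_node.1 hb).2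
  obtain ⟨-, l1, r1, a1⟩ := fForest_spec cs (isBeta_node.1 hb).2
  obtain ⟨p2, l2, r2, a2⟩ := fForest_spec ds h2
  rw [h, h1, f, f, l1, l2, r1, r2]
  refine ⟨?_, h6.symm, by omega⟩
  -- Both ascent numbers are leaf numbers minus one, and the leaf numbers add up to `n + 1`, so the
  -- ascents add up to `n - 1`. The empty forest is separate, as truncated subtraction hides the
  -- failure of `asc + 1 = leaves` there.
  have had := PermWord.asc_add_des p2.1.nodup
  rw [p2.1.length] at had
  rcases eq_or_ne cs [] with rfl | hne
  · rw [sizeForest] at h4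
    rw [fForest, PermWord.asc_nil]
    omega
  · have hds : ds ≠ [] := by
      rintro rfl
      obtain ⟨c, cs, rfl⟩ := List.exists_cons_of_ne_nil hne
      have := size_pos c
      simp only [sizeForest] at h4
      omega
    have := a1 hne
    have := a2 hds
    have := h5 hne
    omega

end LTree

-- Transport of the involution from trees to avoiders.

theorem corollary3 (n : ℕ) :
    Set.BijOn LTree.f (LTree.betaTrees (n + 1)) (PermWord.avoiders n) ∧
    Set.MapsTo LTree.h (LTree.betaTrees (n + 1)) (LTree.betaTrees (n + 1)) ∧
    Set.MapsTo (LTree.conjH n) (PermWord.avoiders n) (PermWord.avoiders n) ∧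
    (∀ π ∈ PermWord.avoiders n, LTree.conjH n (LTree.conjH n π) = π) ∧
    (∀ π ∈ PermWord.avoiders n,
      (PermWord.asc π, PermWord.lmax π, PermWord.rmax π) =
        (PermWord.des (LTree.conjH n π), PermWord.rmax (LTree.conjH n π),
          PermWord.lmax (LTree.conjH n π))) := by
  have hf := LTree.bijOn_f n
  have hh := LTree.mapsTo_h n
  have hconj : ∀ t ∈ LTree.betaTrees (n + 1), LTree.conjH n (LTree.f t) = LTree.f (LTree.h t) := by
    intro t ht
    rw [LTree.conjH, hf.injOn.leftInvOn_invFunOn ht]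
  refine ⟨hf, hh, ?_, ?_, ?_⟩
  · intro π hπ
    obtain ⟨t, ht, rfl⟩ := hf.surjOn hπ
    rw [hconj t ht]
    exact hf.mapsTo (hh ht)
  · intro π hπ
    obtain ⟨t, ht, rfl⟩ := hf.surjOn hπ
    rw [hconj t ht, hconj _ (hh ht), LTree.h_h_of_isBeta ht.1]
  · intro π hπ
    obtain ⟨t, ht, rfl⟩ := hf.surjOn hπ
    obtain ⟨h1, h2, h3⟩ := LTree.stats_f_h ht
    rw [hconj t ht, h1, h2, h3]
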